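/- An instance of the replenishment problem with fixed turnover times (RFTT) consists of a connected undirected graph $G$ on a depot $s$ and $n$ clients $v_1,\dots,v_n$, with nonnegative rational edge weights, and of a positive integer turnover time $\tau_j$ for every client $v_j$. A tour is a closed walk in $G$ that starts and ends in $s$; its length is the sum of the weights of its edges, counted with multiplicity. A solution assigns a tour to each day $0,1,2,\dots$; it is feasible if for every $j$ the client $v_j$ is visited at least once in every $\tau_j$ consecutive days. The value of a solution in min-max RFTT is the supremum of its tour lengths over all days, and $\mathrm{OPT}$ is the infimum of the values of the feasible solutions. **Theorem.** Min-max RFTT on general (weighted graph) metrics has a polynomial-time $O(\log n)$-approximation algorithm: there are a function $\rho:\mathbb N\to\mathbb R$ with $\rho(n)=O(\log n)$ as $n\to\infty$ and an algorithm that, for every instance with $n$ clients, outputs a feasible periodic solution of value at most $\rho(n)\cdot\mathrm{OPT}$, in time polynomial in the length of the instance, with all numbers (turnover times, numerators and denominators of the weights) written in binary. Here the time is that of a random access machine with logarithmic cost, and the solution is output explicitly as a finite list of triples $(p,r,T)$ with integers $p\ge 1$, $r\ge 0$ and a tour $T$, meaning that on each day $k$ one makes, one after the other, all listed tours $T$ for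 which $k\equiv r \pmod p$. -/

import Mathlib

open scoped ENNReal NNRat

/-! ### The model of computation

A structured random access machine with logarithmic cost.  The memory consists of arrays of natural
numbers; every elementary operation is charged the bit lengths of the numbers it handles. -/

namespace RAM

/-- The memory: `σ a i` is the content of cell `i` of array `a`. -/
abbrev State := ℕ → ℕ → ℕ

/-- Arithmetic operations on natural numbers (truncated subtraction, integer division with
`x / 0 = 0`). -/
inductive Op
  | add
  | sub
  | mul
  | div

def Op.eval : Op → ℕ → ℕ → ℕ
  | .add, x, y => x + y
  | .sub, x, y => x - y
  | .mul, x, y => x * y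
  | .div, x, y => x / y

/-- Expressions: constants, array reads with a computed index, and arithmetic. -/
inductive Expr
  | const (k : ℕ)
  | get (a : ℕ) (i : Expr)
  | bin (o : Op) (e f : Expr)

def Expr.eval (σ : State) : Expr → ℕ
  | .const k => k
  | .get a i => σ a (i.eval σ)
  | .bin o e f => o.eval (e.eval σ) (f.eval σ)

/-- The time for evaluating an expression: each node costs one plus the bit length of its value.
In particular, a read is charged for the address and for the content. -/
def Expr.cost (σ : State) : Expr → ℕ
  | .const k => 1 + k.size
  | .get a i => i.cost σ + (1 + (σ a (i.eval σ)).size)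
  | .bin o e f => e.cost σ + f.cost σ + (1 + (o.eval (e.eval σ) (f.eval σ)).size)

/-- Programs. `set a i e` writes the value of `e` into cell `i` of array `a`; tests succeed on
nonzero values. -/
inductive Cmd
  | skip
  | set (a : ℕ) (i e : Expr)
  | seq (P Q : Cmd)
  | ite (e : Expr) (P Q : Cmd)
  | loop (e : Expr) (P : Cmd)

def State.write (σ : State) (a i x : ℕ) : State :=
  Function.update σ a (Function.update (σ a) i x)

/-- `Exec P σ σ' t`: started in memory `σ`, the program `P` halts with memory `σ'` after time
`t`. -/
inductive Exec : Cmd → State → State → ℕ → Prop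
  | skip (σ : State) : Exec .skip σ σ 1
  | set (σ : State) (a : ℕ) (i e : Expr) :
      Exec (.set a i e) σ (σ.write a (i.eval σ) (e.eval σ)) (i.cost σ + e.cost σ + 1)
  | seq {P Q : Cmd} {σ σ₁ σ₂ : State} {t₁ t₂ : ℕ} :
      Exec P σ σ₁ t₁ → Exec Q σ₁ σ₂ t₂ → Exec (.seq P Q) σ σ₂ (t₁ + t₂)
  | ite_true {e : Expr} {P Q : Cmd} {σ σ' : State} {t : ℕ} :
      e.eval σ ≠ 0 → Exec P σ σ' t → Exec (.ite e P Q) σ σ' (e.cost σ + 1 + t)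
  | ite_false {e : Expr} {P Q : Cmd} {σ σ' : State} {t : ℕ} :
      e.eval σ = 0 → Exec Q σ σ' t → Exec (.ite e P Q) σ σ' (e.cost σ + 1 + t)
  | loop_true {e : Expr} {P : Cmd} {σ σ₁ σ₂ : State} {t₁ t₂ : ℕ} :
      e.eval σ ≠ 0 → Exec P σ σ₁ t₁ → Exec (.loop e P) σ₁ σ₂ t₂ →
      Exec (.loop e P) σ σ₂ (e.cost σ + 1 + t₁ + t₂)
  | loop_false {e : Expr} {P : Cmd} {σ : State} :
      e.eval σ = 0 → Exec (.loop e P) σ σ (e.cost σ + 1)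

/-- The initial memory: the input is in array `0`, everything else is zero. -/
def input (l : List ℕ) : State := fun a i => if a = 0 then l.getD i 0 else 0

/-- The memory `σ` holds the output `l`, in array `1`. -/
def Outputs (σ : State) (l : List ℕ) : Prop := ∀ (i : ℕ) (h : i < l.length), σ 1 i = l[i]

/-- The length of an input in bits, with one extra symbol per number as a separator. -/
def bitLength (l : List ℕ) : ℕ := (l.map fun x => x.size + 1).sum

end RAM

/-! ### The replenishment problem with fixed turnover times -/

namespace RFTT

/-- An instance: a connected graph on the vertices `0, …, n` with nonnegative rational edge weights,
where `0` is the depot and `1, …, n` are the clients, and for each client a positive turnover time.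
Only the values of `c` on edges of `G` matter. -/
structure Instance where
  n : ℕ
  G : SimpleGraph (Fin (n + 1))
  connected : G.Connected
  c : Sym2 (Fin (n + 1)) → ℚ≥0
  /-- `τ j` is the turnover time of the client at the vertex `j.succ`. -/
  τ : Fin n → ℕ
  τ_pos : ∀ j, 0 < τ j

namespace Instance

variable (I : Instance)

/-- A tour is a closed walk in the graph that starts and ends in the depot. -/
abbrev Tour := I.G.Walk 0 0

/-- The length of a tour: the sum of the weights of its edges, with multiplicity. -/
def tourLength (T : I.Tour) : ℚ≥0 := (T.edges.map I.c).sum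

/-- A solution prescribes a tour for each day `0, 1, 2, …`. -/
abbrev Solution := ℕ → I.Tour

/-- Each client `j` is visited at least once in every `τ j` consecutive days. -/
def Feasible (S : I.Solution) : Prop :=
  ∀ (j : Fin I.n) (t : ℕ), ∃ k, t ≤ k ∧ k < t + I.τ j ∧ j.succ ∈ (S k).support

/-- The objective: the maximum (supremum) of the tour lengths over all days. -/
noncomputable def maxTourLength (S : I.Solution) : ℝ≥0∞ :=
  ⨆ k, ENNReal.ofReal (I.tourLength (S k) : ℝ)

/-- The optimal value: the infimum of the objective over all feasible solutions, periodic or not. -/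
noncomputable def optMinMax : ℝ≥0∞ :=
  ⨅ (S : I.Solution) (_ : I.Feasible S), I.maxTourLength S

open Classical in
/-- The instance as a list of numbers: `n`, the turnover times, and the weighted adjacency matrix
row by row, with `1, p, q` for an edge of weight `p / q` and `0, 0, 0` for a non-edge. -/
noncomputable def encode : List ℕ :=
  I.n :: (List.ofFn I.τ ++
    (List.finRange (I.n + 1)).flatMap fun i => (List.finRange (I.n + 1)).flatMap fun j =>
      if I.G.Adj i j then [1, (I.c s(i, j)).num, (I.c s(i, j)).den] else [0, 0, 0])

/-- One line of a timetable: a tour that is made on all days that are congruent to `offset` modulo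
`period`. -/
structure Entry where
  period : ℕ
  period_pos : 0 < period
  offset : ℕ
  tour : I.Tour

variable {I}

/-- The solution described by a timetable: on day `k`, make all tours that are due on that day,
one after the other. -/
def solutionOf : List I.Entry → I.Solution
  | [], _ => .nil
  | e :: L, k =>
      if k ≡ e.offset [MOD e.period] then e.tour.append (solutionOf L k) else solutionOf L k

/-- A line as a list of numbers: period, offset, number of vertices in the list that follows, and
the vertices of the tour in order. -/
def Entry.encode (e : I.Entry) : List ℕ :=
  e.period :: e.offset :: e.tour.support.length :: e.tour.support.map Fin.val

/-- A timetable as a list of numbers: the number of lines, followed by the lines. -/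
def encodeTimetable (L : List I.Entry) : List ℕ :=
  L.length :: L.flatMap Entry.encode

end Instance

/-- The program `P` is a polynomial-time approximation algorithm for min-max RFTT with ratio `ρ n`
on the instances with `n` clients: in time polynomial in the bit length of the instance, it writes
out a timetable of a feasible periodic solution whose maximum tour length is at most `ρ n` times
the optimum. -/
def IsMinMaxApprox (P : RAM.Cmd) (ρ : ℕ → ℝ) : Prop :=
  ∃ p : Polynomial ℕ, ∀ I : Instance, ∃ (σ : RAM.State) (t : ℕ) (L : List I.Entry),
    RAM.Exec P (RAM.input I.encode) σ t ∧
    t ≤ p.eval (RAM.bitLength I.encode) ∧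
    RAM.Outputs σ (Instance.encodeTimetable L) ∧
    I.Feasible (Instance.solutionOf L) ∧
    (∃ l : ℕ, 0 < l ∧ Function.Periodic (Instance.solutionOf L) l) ∧
    I.maxTourLength (Instance.solutionOf L) ≤ ENNReal.ofReal (ρ I.n) * I.optMinMax

end RFTT

namespace RAM

/-! Multiply all weights by the product `scale` of the denominators, so that lengths are integers,
and let d be the shortest-walk distance. Suppose some feasible solution has all daily tours of
scaled length at most β (`DailyBound`). The algorithm never needs to know β.

Cut the turnover times off at n and sort the clients into classes by the powers of two that enclose
the cut-off values; this gives at most log₂ n + 1 nonempty classes. For the class c, grow a tree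
from the depot by Prim's rule in the metric d, with total cost t. Then t ≤ 2^(c+1) β
(`DailyBound.prim_le`). If 2^(c+1) ≤ n, the tours of the first 2^(c+1) days together form a walk
through the whole class, and a Prim tree costs no more than any such walk (`PrimRun.exists_hops`).
Otherwise each of the at most n attachments costs at most β, because the star at the depot is always
available.

While the tree grows, its vertices receive positions on a line of length 2t, as in the walk around
the doubled tree, such that the line never underestimates d (`TreeState`). Cut this line into 2^c
pieces that contain positions differing by at most 2t / 2^c ≤ 4β. The clients of piece g are visited
in the order of the line on the days congruent to g modulo 2^c. Going there and coming back costs at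
most β, because every client is on some daily tour and hence within β/2 of the depot
(`DailyBound.dist_le`); so the tour has length at most 5β (`visitProg_spec`, `classProg_spec`). Only
one piece per class is due on a day, and the period 2^c does not exceed any turnover time in the
class. Summing over the classes gives the ratio 5 (log₂ n + 1).

For the running time, the algorithm is written in a language `Prog` whose loops all run n + 1 times
and whose stored values gain only additively many bits per assignment. Nesting a fixed number of
such loops keeps both the bit lengths and the time polynomial, whatever the program does
(`exec_compile`, `exists_polynomial_time`). Correctness is then a matter of loop invariants for the
function `Prog.eval` alone. -/

theorem State.write_apply (σ : State) (a i x b j : ℕ) :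
    σ.write a i x b j = if b = a ∧ j = i then x else σ b j := by
  unfold State.write
  by_cases hb : b = a
  · subst hb
    by_cases hj : j = i <;> simp [hj]
  · simp [hb]

theorem State.write_of_ne (σ : State) {a b : ℕ} (i x : ℕ) (h : b ≠ a) :
    σ.write a i x b = σ b := by
  simp [State.write, h]

/-! ### Sizes of expression values -/

/-- All memory cells hold numbers of at most `B` bits. -/
def State.SizeLE (σ : State) (B : ℕ) : Prop := ∀ a i, (σ a i).size ≤ B

/-- Depends on the expression only, not on the memory, so bounds in terms of it are constants of the
program. -/
def Expr.weight : Expr → ℕ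
  | .const k => 1 + k.size
  | .get _ i => 1 + i.weight
  | .bin _ e f => 1 + e.weight + f.weight

theorem size_add_le (x y : ℕ) : (x + y).size ≤ max x.size y.size + 1 := by
  rw [Nat.size_le]
  have hx := Nat.lt_size_self x
  have hy := Nat.lt_size_self y
  have h1 : 2 ^ x.size ≤ 2 ^ max x.size y.size := Nat.pow_le_pow_right (by norm_num) (le_max_left _ _)
  have h2 : 2 ^ y.size ≤ 2 ^ max x.size y.size := Nat.pow_le_pow_right (by norm_num) (le_max_right _ _)
  rw [pow_succ]
  omega

theorem size_mul_le (x y : ℕ) : (x * y).size ≤ x.size + y.size := by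
  rw [Nat.size_le, pow_add]
  exact Nat.mul_lt_mul'' (Nat.lt_size_self x) (Nat.lt_size_self y)

/-- Every operation yields at most one bit more than its operands have together, so bits add up over
the nodes. The factor in front of `B` is harmless for values that are used as addresses or tests and
not stored. -/
theorem Expr.size_eval_le {σ : State} {B : ℕ} (h : σ.SizeLE B) (e : Expr) :
    (e.eval σ).size ≤ e.weight * (B + 1) := by
  induction e with
  | const k => simp only [Expr.eval, Expr.weight]; nlinarith [Nat.zero_le (k.size * B)]
  | get a i _ =>
    have := h a (i.eval σ)
    simp only [Expr.eval, Expr.weight]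
    nlinarith [Nat.zero_le (i.weight * (B + 1))]
  | bin o e f he hf =>
    simp only [Expr.eval, Expr.weight]
    have : ((1 + e.weight + f.weight) * (B + 1))
        = e.weight * (B + 1) + f.weight * (B + 1) + (B + 1) := by ring
    rw [this]
    cases o with
    | add =>
      have := size_add_le (e.eval σ) (f.eval σ)
      have : max (e.eval σ).size (f.eval σ).size ≤ (e.eval σ).size + (f.eval σ).size := by simp
      simp only [Op.eval]; omega
    | sub =>
      have := Nat.size_le_size (Nat.sub_le (e.eval σ) (f.eval σ))
      simp only [Op.eval]; omega
    | mul =>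
      have := size_mul_le (e.eval σ) (f.eval σ)
      simp only [Op.eval]; omega
    | div =>
      have := Nat.size_le_size (Nat.div_le_self (e.eval σ) (f.eval σ))
      simp only [Op.eval]; omega

/-- There are at most `weight` nodes, and the value at each of them has size at most `weight * (B +
1)`; hence the square. -/
theorem Expr.cost_le {σ : State} {B : ℕ} (h : σ.SizeLE B) (e : Expr) :
    e.cost σ ≤ e.weight ^ 2 * (B + 2) := by
  induction e with
  | const k =>
    simp only [Expr.cost, Expr.weight]
    nlinarith [Nat.zero_le k.size, Nat.zero_le (k.size * B), Nat.zero_le (k.size ^ 2 * B)]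
  | get a i hi =>
    have := h a (i.eval σ)
    simp only [Expr.cost, Expr.weight]
    nlinarith [Nat.zero_le (i.weight * (B + 2))]
  | bin o e f he hf =>
    have := Expr.size_eval_le h (.bin o e f)
    simp only [Expr.cost, Expr.weight, Expr.eval] at *
    have h2 : (1 + e.weight + f.weight) ^ 2 * (B + 2) = e.weight ^ 2 * (B + 2) +
      f.weight ^ 2 * (B + 2) + (2 * e.weight * f.weight + e.weight + f.weight) * (B + 2)
        + (1 + e.weight + f.weight) + (1 + e.weight + f.weight) * (B + 1) := by ring
    rw [h2]
    omega

/-- Expressions whose value has only additively more bits than the memory: a product is allowed only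
with an input cell as the second factor. -/
def Expr.tame : Expr → Bool
  | .const _ => true
  | .get _ _ => true
  | .bin .add e f => e.tame && f.tame
  | .bin .mul e (.get 0 _) => e.tame
  | .bin .mul _ _ => false
  | .bin _ e _ => e.tame

/-- The coefficient of `B` is one, in contrast to `Expr.size_eval_le`. This is what keeps iterated
assignments from doubling the bit length each time: a sum takes the maximum of the sizes, and a
product adds only the size of an input cell. -/
theorem Expr.size_eval_le_of_tame {σ : State} {B x : ℕ} (h : σ.SizeLE B) (hx : 1 ≤ x)
    (hin : ∀ i, (σ 0 i).size ≤ x) (e : Expr) (he : e.tame) :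
    (e.eval σ).size ≤ B + e.weight * x := by
  induction e with
  | const k => simp only [Expr.eval, Expr.weight]; nlinarith [Nat.zero_le (k.size * (x-1)), Nat.zero_le k.size]
  | get a i _ => exact (h a (i.eval σ)).trans (Nat.le_add_right _ _)
  | bin o e f ihe ihf =>
    simp only [Expr.eval, Expr.weight]
    have : (1 + e.weight + f.weight) * x = x + e.weight * x + f.weight * x := by ring
    rw [this]
    cases o with
    | add =>
      simp only [Expr.tame, Bool.and_eq_true] at he
      have := size_add_le (e.eval σ) (f.eval σ)
      have := ihe he.1
      have := ihf he.2
      simp only [Op.eval]; omega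
    | sub =>
      have := Nat.size_le_size (Nat.sub_le (e.eval σ) (f.eval σ))
      have := ihe (by simpa [Expr.tame] using he)
      simp only [Op.eval]; omega
    | mul =>
      cases f with
      | get a i =>
        cases a with
        | zero =>
          have := size_mul_le (e.eval σ) (σ 0 (i.eval σ))
          have := ihe (by simpa [Expr.tame] using he)
          have := hin (i.eval σ)
          simp only [Op.eval, Expr.eval]; omega
        | succ a => simp [Expr.tame] at he
      | const k => simp [Expr.tame] at he
      | bin o e f => simp [Expr.tame] at he
    | div =>
      have := Nat.size_le_size (Nat.div_le_self (e.eval σ) (f.eval σ))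
      have := ihe (by simpa [Expr.tame] using he)
      simp only [Op.eval]; omega

/-! ### Bounded loop programs -/

/-- Programs whose only loops are counting loops with as many iterations as the first input number plus
one; the counter is cell `0` of the array `v`. -/
inductive Prog
  | skip
  | set (a : ℕ) (i e : Expr)
  | seq (P Q : Prog)
  | ite (e : Expr) (P Q : Prog)
  | loop (v : ℕ) (P : Prog)

namespace Prog

def eval : Prog → State → State
  | skip, σ => σ
  | set a i e, σ => σ.write a (i.eval σ) (e.eval σ)
  | seq P Q, σ => Q.eval (P.eval σ)
  | ite e P Q, σ => if e.eval σ ≠ 0 then P.eval σ else Q.eval σ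
  | .loop v P, σ => Nat.rec (σ.write v 0 0) (fun i τ => (P.eval τ).write v 0 (i + 1)) (σ 0 0 + 1)

/-- By truncated subtraction this is positive exactly while the counter is at most n; the body sees
the counter values 0, …, n, one for each vertex. -/
def loopTest (v : ℕ) : Expr :=
  .bin .sub (.bin .add (.get 0 (.const 0)) (.const 1)) (.get v (.const 0))

def incr (v : ℕ) : Expr := .bin .add (.get v (.const 0)) (.const 1)

def compile : Prog → Cmd
  | skip => .skip
  | set a i e => .set a i e
  | seq P Q => .seq P.compile Q.compile
  | ite e P Q => .ite e P.compile Q.compile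
  | .loop v P => .seq (.set v (.const 0) (.const 0))
      (.loop (loopTest v) (.seq P.compile (.set v (.const 0) (incr v))))

/-- The arrays that a program writes to. -/
def writes : Prog → List ℕ
  | skip => []
  | set a _ _ => [a]
  | seq P Q => P.writes ++ Q.writes
  | ite _ P Q => P.writes ++ Q.writes
  | .loop v P => v :: P.writes

/-- The input is not written to, loop counters are not written to in the loop body, and all written
values are tame. -/
def WF : Prog → Bool
  | skip => true
  | set a _ e => a != 0 && e.tame
  | seq P Q => P.WF && Q.WF
  | ite _ P Q => P.WF && Q.WF
  | .loop v P => v != 0 && !P.writes.contains v && P.WF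

theorem eval_of_not_mem_writes (P : Prog) (σ : State) {a : ℕ} (h : a ∉ P.writes) :
    P.eval σ a = σ a := by
  induction P generalizing σ with
  | skip => rfl
  | set b i e => exact State.write_of_ne _ _ _ (by simpa [writes] using h)
  | seq P Q hP hQ =>
    simp only [writes, List.mem_append, not_or] at h
    simp only [eval]
    rw [hQ _ h.2, hP _ h.1]
  | ite e P Q hP hQ =>
    simp only [writes, List.mem_append, not_or] at h
    simp only [eval]
    split_ifs
    · exact hP _ h.1
    · exact hQ _ h.2
  | loop v P hP =>
    simp only [writes, List.mem_cons, not_or] at h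
    suffices ∀ m, (Nat.rec (σ.write v 0 0) (fun i τ => (P.eval τ).write v 0 (i + 1)) m : State) a
        = σ a from this (σ 0 0 + 1)
    intro m
    induction m with
    | zero => exact State.write_of_ne _ _ _ h.1
    | succ m ih => exact (State.write_of_ne _ _ _ h.1).trans ((hP _ h.2).trans ih)

theorem not_mem_writes_of_WF {P : Prog} (h : P.WF) : 0 ∉ P.writes := by
  induction P with
  | skip => simp [writes]
  | set b i e => simp [WF] at h; simp [writes]; omega
  | seq P Q hP hQ => simp [WF] at h; simp [writes, hP h.1, hQ h.2]
  | ite e P Q hP hQ => simp [WF] at h; simp [writes, hP h.1, hQ h.2]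
  | loop v P hP => simp [WF] at h; simp [writes, hP h.2]; omega

theorem eval_input {P : Prog} (h : P.WF) (σ : State) : P.eval σ 0 = σ 0 :=
  eval_of_not_mem_writes P σ (not_mem_writes_of_WF h)

/-- The invariant rule for loops. -/
theorem loop_induction {v : ℕ} {P : Prog} {σ : State} (Inv : ℕ → State → Prop)
    (h0 : Inv 0 (σ.write v 0 0))
    (hs : ∀ i ≤ σ 0 0, ∀ τ : State, τ v 0 = i → Inv i τ → Inv (i + 1) ((P.eval τ).write v 0 (i + 1))) :
    Inv (σ 0 0 + 1) ((Prog.loop v P).eval σ) := by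
  simp only [eval]
  suffices ∀ m, m ≤ σ 0 0 + 1 → ∀ τ : State,
      Nat.rec (σ.write v 0 0) (fun i τ => (P.eval τ).write v 0 (i + 1)) m = τ →
      τ v 0 = m ∧ Inv m τ from (this _ le_rfl _ rfl).2
  intro m
  induction m with
  | zero => rintro - τ rfl; exact ⟨by simp [State.write_apply], h0⟩
  | succ m ih =>
    rintro hm τ rfl
    obtain ⟨h1, h2⟩ := ih (by omega) _ rfl
    exact ⟨by simp [State.write_apply], hs m (by omega) _ h1 h2⟩

/-! ### Running time -/

open Polynomial in
/-- A bound for the growth of the bit lengths. -/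
noncomputable def growth : Prog → ℕ[X]
  | skip => 0
  | set _ _ e => (e.weight : ℕ[X]) * X
  | seq P Q => P.growth + Q.growth
  | ite _ P Q => P.growth + Q.growth
  | .loop _ P => X * (P.growth + X) + X

open Polynomial in
noncomputable def exprTime (U : ℕ[X]) (e : Expr) : ℕ[X] := (e.weight ^ 2 : ℕ) * (U + 2)

open Polynomial in
/-- A bound for the running time if all bit lengths are at most `U`. -/
noncomputable def time (U : ℕ[X]) : Prog → ℕ[X]
  | skip => 1
  | set _ i e => exprTime U i + exprTime U e + 1
  | seq P Q => P.time U + Q.time U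
  | ite e P Q => exprTime U e + 1 + (P.time U + Q.time U)
  | .loop v P => exprTime U (.const 0) + exprTime U (.const 0) + 1 +
      (X * (exprTime U (loopTest v) + 1 + P.time U +
        (exprTime U (.const 0) + exprTime U (incr v) + 1)) + (exprTime U (loopTest v) + 1))

theorem cost_le_exprTime {σ : State} {B x : ℕ} {U : Polynomial ℕ} (h : σ.SizeLE B)
    (hU : B ≤ U.eval x) (e : Expr) : e.cost σ ≤ (exprTime U e).eval x := by
  refine (Expr.cost_le h e).trans ?_
  simp only [exprTime, Polynomial.eval_mul, Polynomial.eval_add, Polynomial.eval_natCast,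
    Polynomial.eval_ofNat]
  gcongr
  exact le_rfl

theorem SizeLE.write {σ : State} {B C a i x : ℕ} (h : σ.SizeLE B) (hBC : B ≤ C) (hx : x.size ≤ C) :
    (σ.write a i x).SizeLE C := by
  intro b j
  rw [State.write_apply]
  split_ifs
  · exact hx
  · exact (h b j).trans hBC

/-- Here `x` bounds the input sizes and the iteration number, and `U` bounds every bit length that
occurs, so each expression has a fixed polynomial cost. In a loop, one iteration adds at most `g +
x` bits (body and counter), and there are at most `x` iterations, hence polynomial growth is
preserved under nesting. -/
theorem exec_compile (U : Polynomial ℕ) (x : ℕ) (P : Prog) (hP : P.WF) (σ : State) (B : ℕ)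
    (hB : σ.SizeLE B) (hin : ∀ i, (σ 0 i).size ≤ x) (hn : σ 0 0 + 1 ≤ x)
    (hU : B + P.growth.eval x ≤ U.eval x) :
    ∃ t, Exec P.compile σ (P.eval σ) t ∧ t ≤ (P.time U).eval x ∧
      (P.eval σ).SizeLE (B + P.growth.eval x) := by
  induction P generalizing σ B with
  | skip => exact ⟨1, .skip σ, by simp [time], by simpa [growth, eval] using hB⟩
  | set a i e =>
    simp only [WF, Bool.and_eq_true] at hP
    refine ⟨_, .set σ a i e, ?_, ?_⟩
    · have h1 := cost_le_exprTime hB (by omega : B ≤ U.eval x) i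
      have h2 := cost_le_exprTime hB (by omega : B ≤ U.eval x) e
      simp only [time, Polynomial.eval_add, Polynomial.eval_one]
      omega
    · simp only [growth, Polynomial.eval_mul, Polynomial.eval_natCast, Polynomial.eval_X]
      exact SizeLE.write hB (by omega) (Expr.size_eval_le_of_tame hB (by omega) hin e hP.2)
  | seq P Q ihP ihQ =>
    simp only [WF, Bool.and_eq_true] at hP
    simp only [growth, Polynomial.eval_add] at hU
    obtain ⟨t₁, h1, h2, h3⟩ := ihP hP.1 σ B hB hin hn (by omega)
    have h0 := eval_input hP.1 σ
    obtain ⟨t₂, k1, k2, k3⟩ := ihQ hP.2 (P.eval σ) _ h3 (by rwa [h0]) (by rwa [h0]) (by omega)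
    refine ⟨_, .seq h1 k1, ?_, ?_⟩
    · simp only [time, Polynomial.eval_add]; omega
    · simp only [growth, Polynomial.eval_add, ← add_assoc]; exact k3
  | ite e P Q ihP ihQ =>
    simp only [WF, Bool.and_eq_true] at hP
    simp only [growth, Polynomial.eval_add] at hU
    have hc := cost_le_exprTime hB (by omega : B ≤ U.eval x) e
    simp only [time, growth, Polynomial.eval_add, Polynomial.eval_one, eval]
    by_cases he : e.eval σ = 0
    · obtain ⟨t₁, h1, h2, h3⟩ := ihQ hP.2 σ B hB hin hn (by omega)
      refine ⟨_, .ite_false he (by simpa [he] using h1), by omega, ?_⟩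
      simp only [he, ne_eq, not_true_eq_false, ite_false]
      exact fun a i => (h3 a i).trans (by omega)
    · obtain ⟨t₁, h1, h2, h3⟩ := ihP hP.1 σ B hB hin hn (by omega)
      refine ⟨_, .ite_true he (by simpa [he] using h1), by omega, ?_⟩
      simp only [he, ne_eq, not_false_eq_true, ite_true]
      exact fun a i => (h3 a i).trans (by omega)
  | loop v P ih =>
    simp only [WF, Bool.and_eq_true, bne_iff_ne, Bool.not_eq_true', ne_eq] at hP
    obtain ⟨⟨hv, hvP⟩, hP⟩ := hP
    have hvP : v ∉ P.writes := by simpa using hvP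
    simp only [growth, Polynomial.eval_add, Polynomial.eval_mul, Polynomial.eval_X] at hU
    set g := P.growth.eval x with hg
    set m := σ 0 0 + 1 with hm
    set F : ℕ → State := fun k => Nat.rec (σ.write v 0 0)
      (fun i τ => (P.eval τ).write v 0 (i + 1)) k with hF
    have hFs : ∀ k, F (k + 1) = (P.eval (F k)).write v 0 (k + 1) := fun k => rfl
    have hF0 : ∀ k, F k 0 = σ 0 := by
      intro k
      induction k with
      | zero => exact State.write_of_ne _ _ _ (Ne.symm hv)
      | succ k ihk => rw [hFs, State.write_of_ne _ _ _ (Ne.symm hv), eval_input hP, ihk]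
    have hFv : ∀ k, F k v 0 = k := by
      intro k
      cases k with
      | zero => simp [hF, State.write_apply]
      | succ k => rw [hFs]; simp [State.write_apply]
    set b : ℕ := (exprTime U (loopTest v) + 1 + P.time U +
        (exprTime U (.const 0) + exprTime U (incr v) + 1)).eval x with hb
    have hbound : ∀ k, k ≤ m → B + k * (g + x) + x ≤ U.eval x := by
      intro k hk
      have : k * (g + x) ≤ x * (g + x) := Nat.mul_le_mul_right _ (by omega)
      omega
    have hstep : ∀ k, k < m → (F k).SizeLE (B + k * (g + x)) →
        ∃ t, Exec (.seq P.compile (.set v (.const 0) (incr v))) (F k) (F (k + 1)) t ∧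
          (loopTest v).cost (F k) + 1 + t ≤ b ∧ (F (k + 1)).SizeLE (B + (k + 1) * (g + x)) := by
      intro k hk hS
      have hbk := hbound (k + 1) hk
      have e1 : (k + 1) * (g + x) = k * (g + x) + g + x := by ring
      obtain ⟨t, h1, h2, h3⟩ := ih hP (F k) _ hS (by rwa [hF0]) (by rwa [hF0])
        (by omega)
      change (P.eval (F k)).SizeLE (B + k * (g + x) + g) at h3
      have hPv : P.eval (F k) v 0 = k := by rw [eval_of_not_mem_writes P _ hvP, hFv]
      have hset := Exec.set (P.eval (F k)) v (.const 0) (incr v)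
      have hval : (incr v).eval (P.eval (F k)) = k + 1 := by
        simp [incr, Expr.eval, Op.eval, hPv]
      rw [hval] at hset
      refine ⟨_, .seq h1 hset, ?_, ?_⟩
      · have c1 := cost_le_exprTime hS (by omega : B + k * (g + x) ≤ U.eval x) (loopTest v)
        have c2 := cost_le_exprTime h3 (by omega : B + k * (g + x) + g ≤ U.eval x) (.const 0)
        have c3 := cost_le_exprTime h3 (by omega : B + k * (g + x) + g ≤ U.eval x) (incr v)
        simp only [hb, Polynomial.eval_add, Polynomial.eval_one]
        omega
      · rw [hFs]
        refine SizeLE.write h3 (by omega) ?_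
        have h4 := h3 v 0
        rw [hPv] at h4
        have : (k + 1).size ≤ k.size + 1 := by
          rw [Nat.size_le, pow_succ]
          have := Nat.lt_size_self k
          omega
        omega
    have hsize : ∀ k, k ≤ m → (F k).SizeLE (B + k * (g + x)) := by
      intro k
      induction k with
      | zero => intro _; exact SizeLE.write hB (by omega) (by simp)
      | succ k ihk => intro hk; exact (hstep k hk (ihk (by omega))).choose_spec.2.2
    have htest : ∀ k, (loopTest v).eval (F k) = m - k := by
      intro k
      simp [loopTest, Expr.eval, Op.eval, hFv, hF0, hm]
    set l : ℕ := (exprTime U (loopTest v) + 1).eval x with hl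
    -- Induction on the number `j` of remaining iterations, since `Exec` unfolds a loop from the
    -- front.
    have hloop : ∀ j k, k + j = m → ∃ t, Exec (.loop (loopTest v)
        (.seq P.compile (.set v (.const 0) (incr v)))) (F k) (F m) t ∧ t ≤ j * b + l := by
      intro j
      induction j with
      | zero =>
        intro k hk
        obtain rfl : k = m := by omega
        refine ⟨_, .loop_false (by have := htest m; omega), ?_⟩
        have := cost_le_exprTime (hsize _ le_rfl)
          (by have := hbound _ le_rfl; omega) (loopTest v) (x := x) (U := U)
        simp only [hl, Polynomial.eval_add, Polynomial.eval_one]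
        omega
      | succ j ihj =>
        intro k hk
        obtain ⟨t₂, h1, h2⟩ := ihj (k + 1) (by omega)
        obtain ⟨t₁, k1, k2, -⟩ := hstep k (by omega) (hsize k (by omega))
        refine ⟨_, .loop_true (by rw [htest]; omega) k1 h1, ?_⟩
        have : (j + 1) * b = j * b + b := by ring
        omega
    obtain ⟨t, h1, h2⟩ := hloop m 0 (by omega)
    refine ⟨_, .seq (.set σ v (.const 0) (.const 0)) h1, ?_, ?_⟩
    · have c1 := cost_le_exprTime hB (by have := hbound 0 (by omega); omega) (.const 0)
        (x := x) (U := U)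
      have e1 : ((Prog.loop v P).time U).eval x = (exprTime U (.const 0)).eval x
          + (exprTime U (.const 0)).eval x + 1 + (x * b + l) := by
        simp only [time, hb, hl, Polynomial.eval_add, Polynomial.eval_mul, Polynomial.eval_X,
          Polynomial.eval_one]
      have e2 : m * b ≤ x * b := Nat.mul_le_mul_right _ hn
      rw [e1]
      omega
    · have := hsize m le_rfl
      intro a i
      refine (this a i).trans ?_
      have : m * (g + x) ≤ x * (g + x) := Nat.mul_le_mul_right _ hn
      simp only [growth, Polynomial.eval_add, Polynomial.eval_mul, Polynomial.eval_X, ← hg]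
      omega

/-- Every well-formed program runs in polynomial time on lists that are longer than their first
entry. -/
theorem exists_polynomial_time (P : Prog) (hP : P.WF) :
    ∃ p : Polynomial ℕ, ∀ l : List ℕ, l.getD 0 0 < l.length →
      ∃ t, Exec P.compile (input l) (P.eval (input l)) t ∧ t ≤ p.eval (bitLength l) := by
  refine ⟨P.time (Polynomial.X + P.growth), fun l hl => ?_⟩
  -- Together with `hl` this bounds the number of iterations by the bit length; a number written in
  -- binary could otherwise be exponentially large.
  have hlen : l.length ≤ bitLength l := by
    clear hl
    induction l with
    | nil => simp
    | cons a l ih => simp [bitLength] at ih ⊢; omega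
  have hmem : ∀ y ∈ l, y.size ≤ bitLength l := by
    intro y hy
    refine le_trans ?_ (List.single_le_sum (by simp) (y.size + 1) (List.mem_map_of_mem hy))
    omega
  have hin : ∀ i, (l.getD i 0).size ≤ bitLength l := by
    intro i
    by_cases hi : i < l.length
    · rw [List.getD_eq_getElem _ _ hi]; exact hmem _ (List.getElem_mem hi)
    · rw [List.getD_eq_default _ _ (by omega)]; simp
  obtain ⟨t, h1, h2, -⟩ := exec_compile (Polynomial.X + P.growth) (bitLength l) P hP (input l)
    (bitLength l) (by
      intro a i
      simp only [input]
      split_ifs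
      · exact hin i
      · simp) (by simpa [input] using hin) (by simp only [input, ite_true]; omega) (by simp)
  exact ⟨t, h1, h2⟩

end Prog

end RAM

namespace RFTT

/-! ### Weighted walks -/

section Walk

variable {V : Type*} {G : SimpleGraph V} (w : V → V → ℕ)

/-- The weight of a walk. -/
def wlen : ∀ {u v : V}, G.Walk u v → ℕ
  | _, _, .nil => 0
  | u, _, .cons (v := x) _ p => w u x + wlen p

theorem wlen_append {u v x : V} (p : G.Walk u v) (q : G.Walk v x) :
    wlen w (p.append q) = wlen w p + wlen w q := by
  induction p with
  | nil => simp [wlen]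
  | cons h p ih => simp [wlen, ih, add_assoc]

theorem wlen_concat {u v x : V} (p : G.Walk u v) (h : G.Adj v x) :
    wlen w (p.concat h) = wlen w p + w v x := by
  simp [SimpleGraph.Walk.concat_eq_append, wlen_append, wlen]

theorem wlen_reverse (hw : ∀ u v, w u v = w v u) {u v : V} (p : G.Walk u v) :
    wlen w p.reverse = wlen w p := by
  induction p with
  | nil => rfl
  | cons h p ih => simp [wlen, wlen_append, ih, hw, add_comm]

theorem wlen_eq_sum {u v : V} (p : G.Walk u v) :
    wlen w p = ∑ i ∈ Finset.range p.length, w (p.getVert i) (p.getVert (i + 1)) := by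
  induction p with
  | nil => simp [wlen]
  | cons h p ih =>
    rw [wlen, SimpleGraph.Walk.length_cons, Finset.sum_range_succ', ih]
    simp only [SimpleGraph.Walk.getVert_cons_succ, SimpleGraph.Walk.getVert_zero]
    rw [add_comm]

/-- The minimum weight of a walk. -/
noncomputable def minLen (G : SimpleGraph V) (w : V → V → ℕ) (u v : V) : ℕ :=
  sInf {l | ∃ p : G.Walk u v, wlen w p = l}

theorem minLen_le {u v : V} (p : G.Walk u v) : minLen G w u v ≤ wlen w p :=
  Nat.sInf_le ⟨p, rfl⟩

theorem exists_wlen_eq_minLen (hG : G.Connected) (u v : V) :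
    ∃ p : G.Walk u v, wlen w p = minLen G w u v :=
  Nat.sInf_mem (s := {l | ∃ p : G.Walk u v, wlen w p = l}) ⟨_, (hG u v).some, rfl⟩

@[simp]
theorem minLen_self (u : V) : minLen G w u u = 0 :=
  Nat.le_zero.1 (minLen_le w (.nil : G.Walk u u))

theorem minLen_triangle (hG : G.Connected) (u v x : V) :
    minLen G w u x ≤ minLen G w u v + minLen G w v x := by
  obtain ⟨p, hp⟩ := exists_wlen_eq_minLen w hG u v
  obtain ⟨q, hq⟩ := exists_wlen_eq_minLen w hG v x
  rw [← hp, ← hq, ← wlen_append]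
  exact minLen_le w _

theorem minLen_comm (hG : G.Connected) (hw : ∀ u v, w u v = w v u) (u v : V) :
    minLen G w u v = minLen G w v u := by
  suffices ∀ u v, minLen G w u v ≤ minLen G w v u from le_antisymm (this _ _) (this _ _)
  intro u v
  obtain ⟨p, hp⟩ := exists_wlen_eq_minLen w hG v u
  rw [← hp, ← wlen_reverse w hw]
  exact minLen_le w _

theorem minLen_getVert_le (hG : G.Connected) {u v : V} (p : G.Walk u v) {i j : ℕ} (hij : i ≤ j)
    (hj : j ≤ p.length) : minLen G w (p.getVert i) (p.getVert j) ≤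
      ∑ e ∈ Finset.Ico i j, w (p.getVert e) (p.getVert (e + 1)) := by
  induction j, hij using Nat.le_induction with
  | base => simp
  | succ j hij ih =>
    rw [Finset.sum_Ico_succ_top hij]
    refine (minLen_triangle w hG _ (p.getVert j) _).trans (add_le_add (ih (by omega)) ?_)
    simpa [wlen] using minLen_le w (.cons (p.adj_getVert_succ (by omega : j < p.length)) .nil)

/-- A weighted walk can be shortened to one with fewer edges than there are vertices. -/
theorem exists_short_walk [Fintype V] {u v : V} (p : G.Walk u v) :
    ∃ q : G.Walk u v, q.length < Fintype.card V ∧ wlen w q ≤ wlen w p := by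
  classical
  refine ⟨p.bypass, p.bypass_isPath.length_lt, ?_⟩
  have hdrop : ∀ {u v : V} (p : G.Walk u v) (x : V) (hx : x ∈ p.support),
      wlen w (p.dropUntil x hx) ≤ wlen w p := by
    intro u v p x hx
    conv_rhs => rw [← p.take_spec hx, wlen_append]
    omega
  induction p with
  | nil => exact le_rfl
  | cons h p ih =>
    simp only [SimpleGraph.Walk.bypass]
    split_ifs with hs
    · exact (hdrop _ _ hs).trans (ih.trans (by simp [wlen]))
    · simpa [wlen] using ih

end Walk

/-! ### Growing a tree greedily -/

section Prim

variable {V : Type*} [DecidableEq V]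

/-- `PrimRun d r C A t`: growing a tree from `r` by repeatedly attaching a closest vertex of `C`
can lead to the vertex set `A` with total attachment cost `t`. -/
inductive PrimRun (d : V → V → ℕ) (r : V) (C : Set V) : Finset V → ℕ → Prop
  | init : PrimRun d r C {r} 0
  | step {A : Finset V} {t : ℕ} {u v : V} : PrimRun d r C A t → u ∈ A → v ∈ C → v ∉ A →
      (∀ u' ∈ A, ∀ v' ∈ C, v' ∉ A → d u v ≤ d u' v') → PrimRun d r C (insert v A) (t + d u v)

variable {d : V → V → ℕ} {r : V} {C : Set V} {A : Finset V} {t : ℕ}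

theorem PrimRun.root_mem (h : PrimRun d r C A t) : r ∈ A := by
  induction h with
  | init => simp
  | step _ _ _ _ _ ih => exact Finset.mem_insert_of_mem ih

/-- Each attachment could have used the root instead of `u`. The summand `H` on the left accounts
for the root, which costs nothing. -/
theorem PrimRun.le_star (h : PrimRun d r C A t) {H : ℕ} (hH : ∀ v ∈ C, d r v ≤ H) :
    t + H ≤ A.card * H := by
  induction h with
  | init => simp
  | @step A t u v hA hu hv hvA hmin ih =>
    have := (hmin r hA.root_mem v hv hvA).trans (hH v hv)
    rw [Finset.card_insert_of_notMem hvA, add_mul]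
    omega

/-- Any intermediate point with `P` or `Q` splits off a shorter interval of the same kind; a
shortest one has no such point inside. -/
theorem exists_tight_interval (P Q : ℕ → Prop) {i j : ℕ} (hij : i < j) (hi : P i) (hj : Q j) :
    ∃ y z, i ≤ y ∧ y < z ∧ z ≤ j ∧ P y ∧ Q z ∧ ∀ m, y < m → m < z → ¬ P m ∧ ¬ Q m := by
  induction h : j - i using Nat.strong_induction_on generalizing i j with
  | _ k ih =>
    by_cases hm : ∃ m, i < m ∧ m < j ∧ (P m ∨ Q m)
    · obtain ⟨m, h1, h2, h3 | h3⟩ := hm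
      · obtain ⟨y, z, a, b, c, e⟩ := ih (j - m) (by omega) h2 h3 hj rfl
        exact ⟨y, z, by omega, b, c, e⟩
      · obtain ⟨y, z, a, b, c, e⟩ := ih (m - i) (by omega) h1 hi h3 rfl
        exact ⟨y, z, a, b, by omega, e⟩
    · push Not at hm
      exact ⟨i, j, le_rfl, hij, le_rfl, hi, hj, fun m h1 h2 => hm m h1 h2⟩

/-- The greedy tree is not heavier than any walk through all vertices: there is a set `E` of hops of
the walk that can be removed such that every relevant position stays connected to the tree. -/
theorem PrimRun.exists_hops (h : PrimRun d r C A t) (x : ℕ → V) (c : ℕ → ℕ) (L : ℕ)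
    (hr : x 0 = r) (hC : ∀ v ∈ C, ∃ i ≤ L, x i = v)
    (hd : ∀ i j, i ≤ j → j ≤ L → d (x i) (x j) ≤ ∑ e ∈ Finset.Ico i j, c e)
    (hsymm : ∀ u v, d u v = d v u) :
    ↑A ⊆ insert r C ∧ ∃ E ⊆ Finset.range L, t ≤ ∑ e ∈ E, c e ∧
      ∀ i ≤ L, x i ∈ insert r C → ∃ j ≤ L, x j ∈ A ∧ ∀ e ∈ E, min i j ≤ e → max i j ≤ e := by
  induction h with
  | init =>
    exact ⟨by simp, ∅, by simp, by simp, fun i hi _ => ⟨0, by omega, by simp [hr], by simp⟩⟩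
  | @step A t u v hA hu hv hvA hmin ih =>
    obtain ⟨hAR, E, hEL, htE, hconn⟩ := ih
    refine ⟨?_, ?_⟩
    · rw [Finset.coe_insert]
      exact Set.insert_subset (Set.mem_insert_of_mem _ hv) hAR
    obtain ⟨i, hiL, hi⟩ := hC v hv
    obtain ⟨j, hjL, hj, hfree⟩ := hconn i hiL (by rw [hi]; exact Set.mem_insert_of_mem _ hv)
    have hne : i ≠ j := by rintro rfl; exact hvA (hi ▸ hj)
    -- a stretch of the walk between the tree and the remaining vertices
    have key : ∃ lo hi' y z, lo ≤ y ∧ y < z ∧ z ≤ hi' ∧ hi' ≤ L ∧ x lo ∈ insert v A ∧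
        x hi' ∈ insert v A ∧ (∀ e ∈ E, lo ≤ e → hi' ≤ e) ∧ d u v ≤ d (x y) (x z) ∧
        ∀ m, y < m → m < z → x m ∉ insert r C := by
      have hnotR : ∀ m, (x m ∉ A ∧ ¬ (x m ∈ C ∧ x m ∉ A)) → x m ∉ insert r C := by
        rintro m ⟨h1, h2⟩ (h3 | h3)
        · exact h1 (h3 ▸ hA.root_mem)
        · exact h2 ⟨h3, h1⟩
      rcases lt_or_gt_of_ne hne with hlt | hlt
      · obtain ⟨y, z, a1, a2, a3, a4, a5, a6⟩ := exists_tight_interval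
          (fun m => x m ∈ C ∧ x m ∉ A) (fun m => x m ∈ A) hlt (by rw [hi]; exact ⟨hv, hvA⟩) hj
        refine ⟨i, j, y, z, a1, a2, a3, hjL, by simp [hi], by simp [hj], ?_, ?_,
          fun m h1 h2 => hnotR m (a6 m h1 h2).symm⟩
        · intro e he h1
          have := hfree e he
          rw [min_eq_left hlt.le, max_eq_right hlt.le] at this
          exact this h1
        · rw [hsymm (x y)]; exact hmin _ a5 _ a4.1 a4.2
      · obtain ⟨y, z, a1, a2, a3, a4, a5, a6⟩ := exists_tight_interval
          (fun m => x m ∈ A) (fun m => x m ∈ C ∧ x m ∉ A) hlt hj (by rw [hi]; exact ⟨hv, hvA⟩)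
        refine ⟨j, i, y, z, a1, a2, a3, hiL, by simp [hj], by simp [hi], ?_, ?_,
          fun m h1 h2 => hnotR m (a6 m h1 h2)⟩
        · intro e he h1
          have := hfree e he
          rw [min_eq_right hlt.le, max_eq_left hlt.le] at this
          exact this h1
        · exact hmin _ a4 _ a5.1 a5.2
    obtain ⟨lo, hi', y, z, h1, h2, h3, h4, hlo, hhi, hfr, hdist, hgap⟩ := key
    -- The new hops are disjoint from `E` because the stretch from `lo` to `hi'` avoids `E`. They
    -- pay for the new edge by its minimality and the triangle inequality along the walk.
    refine ⟨E ∪ Finset.Ico y z, ?_, ?_, ?_⟩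
    · refine Finset.union_subset hEL fun e he => ?_
      simp only [Finset.mem_Ico, Finset.mem_range] at *; omega
    · rw [Finset.sum_union]
      · exact add_le_add htE (hdist.trans (hd y z h2.le (by omega)))
      · rw [Finset.disjoint_left]
        intro e he he'
        have := hfr e he
        simp only [Finset.mem_Ico] at he'; omega
    · intro i' hi'L hR
      have hi'yz : i' ≤ y ∨ z ≤ i' := by
        by_contra hcon
        push Not at hcon
        exact hgap i' hcon.1 hcon.2 hR
      obtain ⟨j', hj'L, hj', hfree'⟩ := hconn i' hi'L hR
      -- If the old connection of `i'` is cut by the new hops, it overlaps the stretch from `lo` to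
      -- `hi'`; the end of the stretch on the side of `i'` lies in the new tree and takes over.
      by_cases hcross : max i' j' ≤ y ∨ z ≤ min i' j'
      · refine ⟨j', hj'L, by simp [hj'], fun e he => ?_⟩
        rcases Finset.mem_union.1 he with he | he
        · exact hfree' e he
        · simp only [Finset.mem_Ico] at he; omega
      · rcases hi'yz with hiy | hiz
        · refine ⟨lo, by omega, hlo, fun e he => ?_⟩
          rcases Finset.mem_union.1 he with he | he
          · have a1 := hfree' e he
            have a2 := hfr e he
            omega
          · simp only [Finset.mem_Ico] at he; omega
        · refine ⟨hi', h4, hhi, fun e he => ?_⟩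
          rcases Finset.mem_union.1 he with he | he
          · have a1 := hfree' e he
            have a2 := hfr e he
            omega
          · simp only [Finset.mem_Ico] at he; omega

theorem PrimRun.le_walk (h : PrimRun d r C A t) (x : ℕ → V) (c : ℕ → ℕ) (L : ℕ)
    (hr : x 0 = r) (hC : ∀ v ∈ C, ∃ i ≤ L, x i = v)
    (hd : ∀ i j, i ≤ j → j ≤ L → d (x i) (x j) ≤ ∑ e ∈ Finset.Ico i j, c e)
    (hsymm : ∀ u v, d u v = d v u) : t ≤ ∑ e ∈ Finset.range L, c e := by
  obtain ⟨-, E, hE, ht, -⟩ := h.exists_hops x c L hr hC hd hsymm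
  exact ht.trans (Finset.sum_le_sum_of_subset hE)

end Prim

end RFTT

namespace RFTT.Instance

variable (I : Instance)

/-! ### Reading the encoding -/

theorem getD_flatMap_finRange {N m : ℕ} (f : Fin N → List ℕ) (hf : ∀ i, (f i).length = m)
    (i : Fin N) {k : ℕ} (hk : k < m) :
    ((List.finRange N).flatMap f).getD (i * m + k) 0 = (f i).getD k 0 := by
  induction N with
  | zero => exact i.elim0
  | succ N ih =>
    rw [List.finRange_succ, List.flatMap_cons, List.flatMap_map]
    refine Fin.cases ?_ (fun i => ?_) i
    · rw [List.getD_append _ _ _ _ (by simp [hf, hk])]; simp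
    · rw [List.getD_append_right _ _ _ _ (by simp [hf, add_mul]; omega), hf]
      convert ih (fun i => f i.succ) (fun i => hf _) i using 2
      simp [add_mul]; omega

theorem length_flatMap_finRange {N m : ℕ} (f : Fin N → List ℕ) (hf : ∀ i, (f i).length = m) :
    ((List.finRange N).flatMap f).length = N * m := by
  simp [List.length_flatMap, hf]

def AdjN (i j : ℕ) : Prop := ∃ (hi : i < I.n + 1) (hj : j < I.n + 1), I.G.Adj ⟨i, hi⟩ ⟨j, hj⟩

/-- The position of the triple of the vertex pair `(i, j)` in the encoding. -/
def slot (n i j : ℕ) : ℕ := 1 + n + 3 * (i * (n + 1) + j)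

/-- The turnover time of the client at the vertex `v`. -/
noncomputable def tau (v : ℕ) : ℕ := I.encode.getD v 0

noncomputable def num (i j : ℕ) : ℕ := I.encode.getD (slot I.n i j + 1) 0

noncomputable def den (i j : ℕ) : ℕ := I.encode.getD (slot I.n i j + 2) 0

theorem encode_getD_zero : I.encode.getD 0 0 = I.n := by simp [encode]

theorem length_encode : I.n < I.encode.length := by
  simp [encode]

theorem tau_succ (j : Fin I.n) : I.tau (j + 1) = I.τ j := by
  simp only [tau, encode, List.getD_cons_succ]
  rw [List.getD_append _ _ _ _ (by simp), List.getD_eq_getElem _ _ (by simp)]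
  simp

open Classical in
theorem encode_getD_slot (i j : Fin (I.n + 1)) {k : ℕ} (hk : k < 3) :
    I.encode.getD (slot I.n i j + k) 0 =
      (if I.G.Adj i j then [1, (I.c s(i, j)).num, (I.c s(i, j)).den] else [0, 0, 0]).getD k 0 := by
  have e : slot I.n i j + k = I.n + (i * ((I.n + 1) * 3) + (j * 3 + k)) + 1 := by
    unfold slot; ring
  rw [e, encode, List.getD_cons_succ, List.getD_append_right _ _ _ _ (by simp),
    List.length_ofFn, Nat.add_sub_cancel_left]
  rw [getD_flatMap_finRange (m := (I.n + 1) * 3), getD_flatMap_finRange (m := 3)]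
  · intro i'; split_ifs <;> rfl
  · exact hk
  · intro i'
    exact length_flatMap_finRange _ (fun j' => by split_ifs <;> rfl)
  · have := j.isLt; omega

theorem adjN_iff (i j : Fin (I.n + 1)) : I.AdjN i j ↔ I.G.Adj i j := by
  simp [AdjN, i.isLt, j.isLt]

theorem AdjN.symm {I : Instance} {i j : ℕ} (h : I.AdjN i j) : I.AdjN j i :=
  ⟨h.2.1, h.1, h.2.2.symm⟩

theorem flag_ne_zero_iff {i j : ℕ} (hi : i ≤ I.n) (hj : j ≤ I.n) :
    I.encode.getD (slot I.n i j) 0 ≠ 0 ↔ I.AdjN i j := by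
  have := I.encode_getD_slot ⟨i, by omega⟩ ⟨j, by omega⟩ (k := 0) (by norm_num)
  simp only [add_zero] at this
  rw [this, ← adjN_iff]
  split_ifs with h <;> simp [h]

theorem num_den_of_adj {i j : Fin (I.n + 1)} (h : I.G.Adj i j) :
    I.num i j = (I.c s(i, j)).num ∧ I.den i j = (I.c s(i, j)).den := by
  have h1 := I.encode_getD_slot i j (k := 1) (by norm_num)
  have h2 := I.encode_getD_slot i j (k := 2) (by norm_num)
  simp only [h, if_true] at h1 h2
  exact ⟨h1, h2⟩

theorem num_eq_zero {i j : ℕ} (hi : i ≤ I.n) (hj : j ≤ I.n) (h : ¬ I.AdjN i j) :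
    I.num i j = 0 := by
  have h1 := I.encode_getD_slot ⟨i, by omega⟩ ⟨j, by omega⟩ (k := 1) (by norm_num)
  rw [if_neg (by rw [← adjN_iff]; exact h)] at h1
  exact h1

/-! ### Integral weights and distances -/

open Classical in
/-- A common denominator of all weights. -/
noncomputable def scale : ℕ :=
  ∏ i ∈ Finset.range (I.n + 1), ∏ j ∈ Finset.range (I.n + 1), if I.AdjN i j then I.den i j else 1

/-- The scaled weight of an edge. -/
noncomputable def W (i j : ℕ) : ℕ := I.scale / I.den i j * I.num i j

noncomputable def wt (u v : Fin (I.n + 1)) : ℕ := I.W u v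

theorem W_eq_zero {i j : ℕ} (hi : i ≤ I.n) (hj : j ≤ I.n) (h : ¬ I.AdjN i j) : I.W i j = 0 := by
  simp [W, I.num_eq_zero hi hj h]

/-- Non-edges are encoded with numerator zero. Standing still is therefore a free step, which lets
the distance recursion treat walks with at most k edges uniformly. -/
theorem W_self {i : ℕ} (hi : i ≤ I.n) : I.W i i = 0 :=
  I.W_eq_zero hi hi fun h => h.2.2.ne rfl

theorem wt_comm (u v : Fin (I.n + 1)) : I.wt u v = I.wt v u := by
  by_cases h : I.G.Adj u v
  · obtain ⟨h1, h2⟩ := I.num_den_of_adj h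
    obtain ⟨h3, h4⟩ := I.num_den_of_adj h.symm
    simp only [wt, W]
    rw [h1, h2, h3, h4, Sym2.eq_swap]
  · simp only [wt]
    rw [I.W_eq_zero (by omega) (by omega) (by rwa [adjN_iff]),
      I.W_eq_zero (by omega) (by omega) (by rw [adjN_iff]; exact fun h' => h h'.symm)]

theorem scale_pos : 0 < I.scale := by
  refine Finset.prod_pos fun i _ => Finset.prod_pos fun j _ => ?_
  split_ifs with h
  · obtain ⟨hi, hj, h⟩ := h
    have := (I.num_den_of_adj h).2
    simp only at this
    rw [this]
    exact NNRat.den_pos _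
  · exact one_pos

theorem den_dvd_scale {u v : Fin (I.n + 1)} (h : I.G.Adj u v) : I.den u v ∣ I.scale := by
  classical
  have h1 := Finset.dvd_prod_of_mem
    (fun i => ∏ j ∈ Finset.range (I.n + 1), if I.AdjN i j then I.den i j else 1)
    (Finset.mem_range.2 u.isLt)
  have h2 := Finset.dvd_prod_of_mem
    (fun j => if I.AdjN u j then I.den u j else 1) (Finset.mem_range.2 v.isLt)
  simp only [(I.adjN_iff u v).2 h, if_true] at h2
  exact h2.trans h1

/-- The division in `W` is exact because the denominator of every edge is a factor of `scale`. -/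
theorem wt_eq {u v : Fin (I.n + 1)} (h : I.G.Adj u v) :
    (I.wt u v : ℚ≥0) = I.scale * I.c s(u, v) := by
  obtain ⟨k, hk⟩ := I.den_dvd_scale h
  obtain ⟨h1, h2⟩ := I.num_den_of_adj h
  have hpos : 0 < I.den u v := by rw [h2]; exact NNRat.den_pos _
  simp only [wt, W]
  rw [hk, Nat.mul_div_cancel_left _ hpos, h1, h2]
  have e := NNRat.mul_den_eq_num (I.c s(u, v))
  push_cast
  rw [← e]
  ring

theorem wlen_eq {u v : Fin (I.n + 1)} (p : I.G.Walk u v) :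
    (wlen I.wt p : ℚ≥0) = I.scale * (p.edges.map I.c).sum := by
  induction p with
  | nil => simp [wlen]
  | cons h p ih => simp [wlen, mul_add, ih, I.wt_eq h]

/-- The distance of two vertices with respect to the scaled weights. -/
noncomputable def dist (i j : ℕ) : ℕ :=
  if h : i < I.n + 1 ∧ j < I.n + 1 then minLen I.G I.wt ⟨i, h.1⟩ ⟨j, h.2⟩ else 0

theorem dist_val (u v : Fin (I.n + 1)) : I.dist u v = minLen I.G I.wt u v := by
  simp [dist, u.isLt, v.isLt]

theorem dist_self (i : ℕ) : I.dist i i = 0 := by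
  unfold dist; split_ifs <;> simp

theorem dist_comm (i j : ℕ) : I.dist i j = I.dist j i := by
  unfold dist
  by_cases h : i < I.n + 1 ∧ j < I.n + 1
  · rw [dif_pos h, dif_pos h.symm]; exact minLen_comm _ I.connected I.wt_comm _ _
  · rw [dif_neg h, dif_neg (fun h' => h h'.symm)]

theorem dist_triangle {i j k : ℕ} (hj : j ≤ I.n) : I.dist i k ≤ I.dist i j + I.dist j k := by
  by_cases h : i < I.n + 1 ∧ k < I.n + 1
  · have hj : j < I.n + 1 := by omega
    have := minLen_triangle I.wt I.connected ⟨i, h.1⟩ ⟨j, hj⟩ ⟨k, h.2⟩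
    simpa [dist, h.1, h.2, hj] using this
  · rw [dist, dif_neg h]; exact Nat.zero_le _

/-! ### Lower bounds -/

/-- Some feasible solution has all its tours of scaled length at most `β`. -/
def DailyBound (β : ℕ) : Prop := ∃ S : I.Solution, I.Feasible S ∧ ∀ k, wlen I.wt (S k) ≤ β

variable {I}

/-- Some tour visits `v`; its part before and its part after this visit are each at least as long as
the distance to the depot. -/
theorem DailyBound.dist_le {β : ℕ} (h : I.DailyBound β) (v : ℕ) : 2 * I.dist 0 v ≤ β := by
  classical
  obtain ⟨S, hS, hβ⟩ := h
  by_cases hv : v < I.n + 1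
  swap
  · simp [dist, hv]
  rcases Nat.eq_zero_or_pos v with rfl | hpos
  · simp [dist_self]
  obtain ⟨k, -, -, hk⟩ := hS ⟨v - 1, by omega⟩ 0
  have e : (⟨v - 1, by omega⟩ : Fin I.n).succ = (⟨v, hv⟩ : Fin (I.n + 1)) := by
    ext; simp; omega
  rw [e] at hk
  have h1 := hβ k
  rw [← (S k).take_spec hk, wlen_append] at h1
  have h2 := minLen_le I.wt ((S k).takeUntil _ hk)
  have h3 := minLen_le I.wt ((S k).dropUntil _ hk)
  rw [minLen_comm _ I.connected I.wt_comm] at h3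
  have h4 := I.dist_val 0 ⟨v, hv⟩
  simp only [Fin.val_zero] at h4
  omega

/-- The tours of the first `m` days, one after the other. -/
def firstDays (S : I.Solution) : ℕ → I.Tour
  | 0 => .nil
  | m + 1 => (firstDays S m).append (S m)

theorem wlen_firstDays_le {S : I.Solution} {β : ℕ} (h : ∀ k, wlen I.wt (S k) ≤ β) (m : ℕ) :
    wlen I.wt (firstDays S m) ≤ m * β := by
  induction m with
  | zero => simp [firstDays, wlen]
  | succ m ih => rw [firstDays, wlen_append, add_mul, one_mul]; exact add_le_add ih (h m)

theorem mem_support_firstDays {S : I.Solution} {m k : ℕ} (hk : k < m) {v : Fin (I.n + 1)}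
    (hv : v ∈ (S k).support) : v ∈ (firstDays S m).support := by
  induction m with
  | zero => omega
  | succ m ih =>
    rw [firstDays, SimpleGraph.Walk.mem_support_append_iff]
    rcases Nat.lt_succ_iff_lt_or_eq.1 hk with h | rfl
    · exact Or.inl (ih h)
    · exact Or.inr hv

/-- Feasibility in the window that starts on day 0 puts every vertex of `C` on the concatenated
tours of the first `m` days, which form one walk from the depot of weight at most `m * β`. -/
theorem DailyBound.prim_le_tours {β : ℕ} (h : I.DailyBound β) {C : Set ℕ} {m : ℕ}
    (hC : ∀ v ∈ C, 1 ≤ v ∧ v ≤ I.n ∧ I.tau v ≤ m) {A : Finset ℕ} {t : ℕ}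
    (hA : PrimRun I.dist 0 C A t) : t ≤ m * β := by
  obtain ⟨S, hS, hβ⟩ := h
  set p := firstDays S m with hp
  refine le_trans ?_ (wlen_firstDays_le hβ m)
  rw [wlen_eq_sum]
  refine hA.le_walk (fun i => (p.getVert i).val) _ p.length (by simp) ?_ ?_ I.dist_comm
  · intro v hv
    obtain ⟨h1, h2, h3⟩ := hC v hv
    obtain ⟨k, -, hk, hmem⟩ := hS ⟨v - 1, by omega⟩ 0
    have ht := I.tau_succ ⟨v - 1, by omega⟩
    simp only [Nat.sub_add_cancel h1] at ht
    obtain ⟨i, hi, hiL⟩ := SimpleGraph.Walk.mem_support_iff_exists_getVert.1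
      (mem_support_firstDays (m := m) (by omega) hmem)
    refine ⟨i, hiL, ?_⟩
    simp only [hp, hi, Fin.val_succ]
    omega
  · intro i j hij hj
    rw [dist_val]
    exact minLen_getVert_le I.wt I.connected p hij hj

/-- The clients of the class `c`: those whose turnover time, cut off at the number of clients, is
between `2 ^ c` and `2 ^ (c + 1)`. -/
def classOf (I : Instance) (c : ℕ) : Set ℕ :=
  {v | 1 ≤ v ∧ v ≤ I.n ∧ 2 ^ c ≤ min (I.tau v) I.n ∧ min (I.tau v) I.n < 2 ^ (c + 1)}

theorem PrimRun.subset {d : ℕ → ℕ → ℕ} {C : Set ℕ} {A : Finset ℕ} {t n : ℕ}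
    (h : PrimRun d 0 C A t) (hC : ∀ v ∈ C, v ≤ n) : A ⊆ Finset.range (n + 1) := by
  induction h with
  | init => simp
  | step hA hu hv hvA hmin ih =>
    refine Finset.insert_subset ?_ ih
    have := hC _ hv
    simp; omega

/-- If 2^(c+1) ≤ n, the cut-off is not effective in this class and the first 2^(c+1) days visit all
of it. Otherwise the turnover times may be arbitrarily large, and the star bound with n < 2^(c+1)
replaces the walk. -/
theorem DailyBound.prim_le {β : ℕ} (h : I.DailyBound β) {c : ℕ} {A : Finset ℕ} {t : ℕ}
    (hA : PrimRun I.dist 0 (I.classOf c) A t) : t ≤ 2 ^ (c + 1) * β := by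
  by_cases hc : 2 ^ (c + 1) ≤ I.n
  · refine h.prim_le_tours (fun v hv => ?_) hA
    obtain ⟨h1, h2, h3, h4⟩ := hv
    refine ⟨h1, h2, ?_⟩
    simp only [inf_lt_iff] at h4
    omega
  · push Not at hc
    have h1 := hA.le_star (H := β) (fun v _ => by have := h.dist_le v; omega)
    have h2 : A.card ≤ I.n + 1 := by
      simpa using Finset.card_le_card (PrimRun.subset hA (n := I.n) fun v hv => hv.2.1)
    have h3 : A.card * β ≤ (I.n + 1) * β := Nat.mul_le_mul_right _ h2
    have h4 : I.n * β ≤ 2 ^ (c + 1) * β := Nat.mul_le_mul_right _ hc.le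
    rw [add_mul] at h3
    omega

/-! ### Timetables -/

theorem solutionOf_append (L M : List I.Entry) (k : ℕ) :
    wlen I.wt (solutionOf (L ++ M) k) = wlen I.wt (solutionOf L k) + wlen I.wt (solutionOf M k) := by
  induction L with
  | nil => simp [solutionOf, wlen]
  | cons e L ih =>
    simp only [List.cons_append, solutionOf]
    split_ifs <;> simp [wlen_append, ih, add_assoc]

theorem wlen_solutionOf_singleton (e : I.Entry) (k : ℕ) :
    wlen I.wt (solutionOf [e] k) = if k ≡ e.offset [MOD e.period] then wlen I.wt e.tour else 0 := by
  simp only [solutionOf]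
  split_ifs <;> simp [wlen]

theorem support_subset_solutionOf {L : List I.Entry} {e : I.Entry} (he : e ∈ L) {k : ℕ}
    (hk : k ≡ e.offset [MOD e.period]) {v : Fin (I.n + 1)} (hv : v ∈ e.tour.support) :
    v ∈ (solutionOf L k).support := by
  induction L with
  | nil => simp at he
  | cons e' L ih =>
    simp only [solutionOf]
    rcases List.mem_cons.1 he with rfl | he
    · rw [if_pos hk, SimpleGraph.Walk.mem_support_append_iff]; exact Or.inl hv
    · split_ifs
      · rw [SimpleGraph.Walk.mem_support_append_iff]; exact Or.inr (ih he)
      · exact ih he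

theorem solutionOf_periodic (L : List I.Entry) :
    ∃ l : ℕ, 0 < l ∧ Function.Periodic (solutionOf L) l := by
  refine ⟨(L.map Entry.period).prod, ?_, ?_⟩
  · refine List.prod_pos fun a ha => ?_
    obtain ⟨e, -, rfl⟩ := List.mem_map.1 ha
    exact e.period_pos
  suffices ∀ m, (L.map Entry.period).prod ∣ m → Function.Periodic (solutionOf L) m from
    this _ dvd_rfl
  intro m hm k
  induction L with
  | nil => rfl
  | cons e L ih =>
    rw [List.map_cons, List.prod_cons] at hm
    simp only [solutionOf]
    rw [ih (dvd_of_mul_left_dvd hm)]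
    have : (k + m ≡ e.offset [MOD e.period]) ↔ (k ≡ e.offset [MOD e.period]) := by
      have h0 : k + m ≡ k + 0 [MOD e.period] :=
        Nat.ModEq.add_left _ ((Nat.modEq_zero_iff_dvd).2 (dvd_of_mul_right_dvd hm))
      exact ⟨fun h => h0.symm.trans h, fun h => h0.trans h⟩
    simp only [this]

/-- The tours of the timetable `L` visit all clients often enough. -/
def Covers (L : List I.Entry) : Prop :=
  ∀ v, 1 ≤ v → v ≤ I.n → ∃ e ∈ L, e.period ≤ I.tau v ∧ v ∈ e.tour.support.map Fin.val

/-- Any window of `e.period` consecutive days meets the residue class of the offset. -/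
theorem feasible_of_covers {L : List I.Entry} (h : Covers L) : I.Feasible (solutionOf L) := by
  intro j t
  obtain ⟨e, he, hτ, hv⟩ := h (j + 1) (by omega) (by omega)
  rw [tau_succ] at hτ
  obtain ⟨v, hv, hvj⟩ := List.mem_map.1 hv
  have hv' : v = j.succ := by ext; simpa using hvj
  have hp := e.period_pos
  obtain ⟨k, h1, h2, h3⟩ : ∃ k, t ≤ k ∧ k < t + e.period ∧ k ≡ e.offset [MOD e.period] := by
    -- The first day from `t` on in the residue class; adding `e.period` before subtracting avoids
    -- truncation.
    refine ⟨t + (e.offset + (e.period - t % e.period)) % e.period, by omega, ?_, ?_⟩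
    · have := Nat.mod_lt (e.offset + (e.period - t % e.period)) hp
      omega
    · have hlt := Nat.mod_lt t hp
      have e1 : t + (e.offset + (e.period - t % e.period)) =
          e.offset + (t / e.period + 1) * e.period := by
        have := Nat.div_add_mod t e.period
        rw [add_mul, mul_comm]
        omega
      unfold Nat.ModEq
      rw [Nat.add_mod_mod, e1, Nat.add_mul_mod_self_right]
  exact ⟨k, h1, by omega, support_subset_solutionOf he h3 (hv' ▸ hv)⟩

/-- The bridge from integral bounds for all β to the infimum over real values: it suffices to
compare with each feasible solution separately, and those of infinite value are trivial. -/
theorem maxTourLength_le {S : I.Solution} {m : ℕ} (hm : 0 < m)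
    (h : ∀ β, I.DailyBound β → ∀ k, wlen I.wt (S k) ≤ m * β) :
    I.maxTourLength S ≤ ENNReal.ofReal m * I.optMinMax := by
  have hm0 : ENNReal.ofReal (m : ℝ) ≠ 0 := by simpa using hm.ne'
  unfold optMinMax
  rw [ENNReal.mul_iInf_of_ne hm0 ENNReal.ofReal_ne_top]
  refine le_iInf fun S' => ?_
  rw [ENNReal.mul_iInf_of_ne hm0 ENNReal.ofReal_ne_top]
  refine le_iInf fun hS' => iSup_le fun k => ?_
  set M := I.maxTourLength S' with hM
  by_cases htop : M = ⊤
  · rw [htop, ENNReal.mul_top hm0]; exact le_top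
  have hscale : (0 : ℝ) < I.scale := by exact_mod_cast I.scale_pos
  have hlen : ∀ T : I.Tour, (wlen I.wt T : ℝ) = I.scale * (I.tourLength T : ℝ) := by
    intro T
    have := I.wlen_eq T
    have h2 := congrArg (fun q : ℚ≥0 => (q : ℝ)) this
    simpa [tourLength] using h2
  -- Scaled tour lengths are integers, so rounding the bound down loses nothing.
  have hβ : I.DailyBound ⌊I.scale * M.toReal⌋₊ := by
    refine ⟨S', hS', fun k => Nat.le_floor ?_⟩
    rw [hlen]
    refine mul_le_mul_of_nonneg_left ?_ hscale.le
    have h1 : ENNReal.ofReal (I.tourLength (S' k) : ℝ) ≤ M :=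
      le_iSup (fun k => ENNReal.ofReal (I.tourLength (S' k) : ℝ)) k
    exact (ENNReal.ofReal_le_iff_le_toReal htop).1 h1
  have h1 : (wlen I.wt (S k) : ℝ) ≤ m * (I.scale * M.toReal) := by
    have h2 : (wlen I.wt (S k) : ℝ) ≤ m * (⌊I.scale * M.toReal⌋₊ : ℝ) := by
      exact_mod_cast h _ hβ k
    exact h2.trans (mul_le_mul_of_nonneg_left (Nat.floor_le (by positivity)) (by positivity))
  rw [hlen] at h1
  rw [← ENNReal.ofReal_toReal htop, ← ENNReal.ofReal_mul (by positivity)]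
  refine ENNReal.ofReal_le_ofReal (le_of_mul_le_mul_left ?_ hscale)
  linarith

end RFTT.Instance

namespace RAM

/-! ### Notation for expressions -/

instance : Add Expr := ⟨.bin .add⟩
instance : Sub Expr := ⟨.bin .sub⟩
instance : Mul Expr := ⟨.bin .mul⟩
instance : Div Expr := ⟨.bin .div⟩

namespace Expr

/-- The register `a`. -/
def reg (a : ℕ) : Expr := .get a (.const 0)

/-- The value `1` if the arguments are equal and `0` otherwise. -/
def eq (e f : Expr) : Expr := .const 1 - ((e - f) + (f - e))

variable (σ : State) (e f : Expr)

@[simp] theorem eval_const (k : ℕ) : (const k).eval σ = k := rfl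
@[simp] theorem eval_get (a : ℕ) : (get a e).eval σ = σ a (e.eval σ) := rfl
@[simp] theorem eval_reg (a : ℕ) : (reg a).eval σ = σ a 0 := rfl
@[simp] theorem eval_add : (e + f).eval σ = e.eval σ + f.eval σ := rfl
@[simp] theorem eval_sub : (e - f).eval σ = e.eval σ - f.eval σ := rfl
@[simp] theorem eval_mul : (e * f).eval σ = e.eval σ * f.eval σ := rfl
@[simp] theorem eval_div : (e / f).eval σ = e.eval σ / f.eval σ := rfl

@[simp] theorem eval_eq : (eq e f).eval σ = if e.eval σ = f.eval σ then 1 else 0 := by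
  simp only [eq, eval_sub, eval_add, eval_const]
  split_ifs <;> omega

end Expr

/-! ### Registers and the search for a minimum -/

namespace Prog

variable (σ : State)

@[simp] theorem eval_skip : skip.eval σ = σ := rfl
@[simp] theorem eval_set (a : ℕ) (i e : Expr) :
    (set a i e).eval σ = σ.write a (i.eval σ) (e.eval σ) := rfl
@[simp] theorem eval_seq (P Q : Prog) : (seq P Q).eval σ = Q.eval (P.eval σ) := rfl

theorem eval_ite (e : Expr) (P Q : Prog) :
    (ite e P Q).eval σ = if e.eval σ ≠ 0 then P.eval σ else Q.eval σ := rfl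

/-- Assign a register. -/
def setReg (a : ℕ) (e : Expr) : Prog := set a (.const 0) e

@[simp] theorem eval_setReg (a : ℕ) (e : Expr) :
    (setReg a e).eval σ = σ.write a 0 (e.eval σ) := rfl

/-- Among the values of register `2` up to `n` for which `g` is nonzero, find one that minimizes
`key`: it is written to register `3`, the minimum to register `4`; register `5` tells whether it
exists. -/
def argmin (g key : Expr) : Prog :=
  seq (setReg 3 (.const 0)) <| seq (setReg 4 (.const 0)) <| seq (setReg 5 (.const 0)) <|
  .loop 2 <| ite g
    (ite ((.const 1 - .reg 5) + (.reg 4 - key))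
      (seq (setReg 4 key) <| seq (setReg 3 (.reg 2)) <| setReg 5 (.const 1)) skip) skip

theorem argmin_frame (g key : Expr) {a : ℕ} (ha : a ∉ [2, 3, 4, 5]) :
    (argmin g key).eval σ a = σ a := by
  refine eval_of_not_mem_writes _ _ ?_
  simp only [argmin, writes, setReg]
  simp at ha ⊢
  omega

/-- The hypothesis lets `g` and `key` read register `2` but otherwise nothing that the search itself
overwrites. The zeros left behind by an unsuccessful search matter later: zero stands for "no walk"
in the distance tables and for the depot as the next destination of a tour. -/
theorem argmin_spec {g key : Expr} {σ : State} (gv kv : ℕ → ℕ)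
    (h : ∀ τ : State, (∀ a ∉ [2, 3, 4, 5], τ a = σ a) →
      g.eval τ = gv (τ 2 0) ∧ key.eval τ = kv (τ 2 0)) {τ : State}
    (hτ : (argmin g key).eval σ = τ) :
    (τ 5 0 = 0 ∧ τ 3 0 = 0 ∧ τ 4 0 = 0 ∧ ∀ x ≤ σ 0 0, gv x = 0) ∨
    (τ 5 0 = 1 ∧ τ 3 0 ≤ σ 0 0 ∧ gv (τ 3 0) ≠ 0 ∧ τ 4 0 = kv (τ 3 0) ∧
      ∀ x ≤ σ 0 0, gv x ≠ 0 → τ 4 0 ≤ kv x) := by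
  subst hτ
  simp only [argmin, eval_seq]
  set σ₀ : State := (setReg 5 (.const 0)).eval
    ((setReg 4 (.const 0)).eval ((setReg 3 (.const 0)).eval σ)) with hσ₀
  have h00 : σ₀ 0 0 = σ 0 0 := by simp [hσ₀, State.write_apply]
  have key := loop_induction (v := 2) (P := ite g
    (ite ((.const 1 - .reg 5) + (.reg 4 - key))
      (seq (setReg 4 key) <| seq (setReg 3 (.reg 2)) <| setReg 5 (.const 1)) skip) skip)
    (σ := σ₀) (fun i τ => (∀ a ∉ [2, 3, 4, 5], τ a = σ a) ∧
      ((τ 5 0 = 0 ∧ τ 3 0 = 0 ∧ τ 4 0 = 0 ∧ ∀ x < i, gv x = 0) ∨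
      (τ 5 0 = 1 ∧ τ 3 0 < i ∧ gv (τ 3 0) ≠ 0 ∧ τ 4 0 = kv (τ 3 0) ∧
      ∀ x < i, gv x ≠ 0 → τ 4 0 ≤ kv x))) ?_ ?_
  · rw [h00] at key
    simpa only [Nat.lt_succ_iff] using key.2
  · refine ⟨fun a ha => ?_, Or.inl ?_⟩
    · simp at ha
      simp [hσ₀, State.write_of_ne, ha]
    · simp [hσ₀, State.write_apply]
  · rintro i hi τ hτi ⟨hfr, hinv⟩
    obtain ⟨hg, hk⟩ := h τ hfr
    rw [hτi] at hg hk
    have hfr' : ∀ e f e' (f' : ℕ), ∀ a ∉ [2, 3, 4, 5],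
        ((((τ.write 4 0 e).write 3 0 f).write 5 0 e').write 2 0 f') a = σ a := by
      intro e f e' f' a ha
      rw [← hfr a ha]
      simp at ha
      simp [State.write_of_ne, ha]
    have hfr2 : ∀ (f' : ℕ), ∀ a ∉ [2, 3, 4, 5], (τ.write 2 0 f') a = σ a := by
      intro f' a ha
      rw [← hfr a ha]
      simp at ha
      simp [State.write_of_ne, ha]
    rw [eval_ite]
    by_cases hgi : gv i = 0
    · rw [if_neg (by rw [hg]; simpa using hgi)]
      refine ⟨hfr2 _, ?_⟩
      simp only [eval_skip, State.write_apply]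
      norm_num
      rcases hinv with ⟨h1, h2, h3, h4⟩ | ⟨h1, h2, h3, h4, h5⟩
      · left
        refine ⟨h1, h2, h3, fun x hx => ?_⟩
        rcases Nat.lt_or_eq_of_le hx with hx | rfl
        · exact h4 x hx
        · exact hgi
      · right
        refine ⟨h1, by omega, h3, h4, fun x hx hgx => ?_⟩
        rcases Nat.lt_or_eq_of_le hx with hx | rfl
        · exact h5 x hx hgx
        · exact absurd hgi hgx
    · rw [if_pos (by rw [hg]; exact hgi), eval_ite]
      simp only [Expr.eval_add, Expr.eval_sub, Expr.eval_const, Expr.eval_reg, hk]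
      -- The test is nonzero if and only if nothing has been found yet or the new key is strictly
      -- smaller.
      split_ifs with hc
      · refine ⟨hfr' _ _ _ _, Or.inr ?_⟩
        simp only [eval_seq, eval_setReg, State.write_apply, Expr.eval_reg, Expr.eval_const]
        norm_num
        rw [hτi, hk]
        refine ⟨by omega, hgi, rfl, fun x hx hgx => ?_⟩
        rcases Nat.lt_or_eq_of_le hx with hx | rfl
        · rcases hinv with ⟨h1, h2, h3, h4⟩ | ⟨h1, h2, h3, h4, h5⟩
          · exact absurd (h4 x hx) hgx
          · have := h5 x hx hgx
            omega
        · exact le_rfl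
      · refine ⟨hfr2 _, ?_⟩
        simp only [eval_skip, State.write_apply]
        norm_num
        rcases hinv with ⟨h1, h2, h3, h4⟩ | ⟨h1, h2, h3, h4, h5⟩
        · omega
        · right
          refine ⟨h1, by omega, h3, h4, fun x hx hgx => ?_⟩
          rcases Nat.lt_or_eq_of_le hx with hx | rfl
          · exact h5 x hx hgx
          · omega

end Prog

end RAM

namespace RFTT

open RAM RAM.Prog RAM.Expr

/-! ### Distances -/

/-- The address of the triple `(k, i, j)` with `i, j ≤ n`. -/
def addr (n k i j : ℕ) : ℕ := k * ((n + 1) * (n + 1)) + (i * (n + 1) + j)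

/-- Uniqueness of mixed-radix digits; the leading digit `k` needs no bound. -/
theorem addr_inj {n k i j k' i' j' : ℕ} (hi : i ≤ n) (hj : j ≤ n) (hi' : i' ≤ n) (hj' : j' ≤ n) :
    addr n k i j = addr n k' i' j' ↔ k = k' ∧ i = i' ∧ j = j' := by
  refine ⟨fun h => ?_, fun ⟨h1, h2, h3⟩ => by rw [h1, h2, h3]⟩
  have aux : ∀ {m a b a' b' : ℕ}, b < m → b' < m → a * m + b = a' * m + b' → a = a' ∧ b = b' := by
    intro m a b a' b' hb hb' h
    have h1 := congrArg (· / m) h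
    have h2 := congrArg (· % m) h
    have hm : 0 < m := by omega
    simp only [Nat.mul_add_mod', Nat.mod_eq_of_lt hb, Nat.mod_eq_of_lt hb'] at h2
    simp only [mul_comm _ m, Nat.mul_add_div hm, Nat.div_eq_of_lt hb, Nat.div_eq_of_lt hb'] at h1
    exact ⟨by omega, h2⟩
  have hlt : ∀ {i j : ℕ}, i ≤ n → j ≤ n → i * (n + 1) + j < (n + 1) * (n + 1) := by
    intro i j hi hj
    have : i * (n + 1) ≤ n * (n + 1) := Nat.mul_le_mul_right _ hi
    have : (n + 1) * (n + 1) = n * (n + 1) + n + 1 := by ring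
    omega
  obtain ⟨h1, h2⟩ := aux (hlt hi hj) (hlt hi' hj') h
  exact ⟨h1, aux (by omega) (by omega) h2⟩

def pairE (i j : Expr) : Expr := i * (reg 0 + const 1) + j

def slotE (i j : Expr) : Expr := const 1 + reg 0 + const 3 * pairE i j

def addrE (k i j : Expr) : Expr := k * ((reg 0 + const 1) * (reg 0 + const 1)) + pairE i j

def flagE (i j : Expr) : Expr := get 0 (slotE i j)
def numE (i j : Expr) : Expr := get 0 (slotE i j + const 1)
def denE (i j : Expr) : Expr := get 0 (slotE i j + const 2)

/-- The scaled weight. -/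
def weightE (i j : Expr) : Expr := reg 9 / denE i j * numE i j

/-- The memory holds the instance. -/
def HasInput (I : Instance) (σ : State) : Prop := ∀ i, σ 0 i = I.encode.getD i 0

theorem HasInput.zero {I : Instance} {σ : State} (h : HasInput I σ) : σ 0 0 = I.n := by
  rw [h, I.encode_getD_zero]

theorem HasInput.congr {I : Instance} {σ τ : State} (h : HasInput I σ) (hτ : τ 0 = σ 0) :
    HasInput I τ := fun i => by rw [hτ, h i]

theorem HasInput.eval_addrE {I : Instance} {σ : State} (h : HasInput I σ) (k i j : Expr) :
    (addrE k i j).eval σ = addr I.n (k.eval σ) (i.eval σ) (j.eval σ) := by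
  simp [addrE, pairE, addr, h.zero]

theorem HasInput.eval_flagE {I : Instance} {σ : State} (h : HasInput I σ) (i j : Expr) :
    (flagE i j).eval σ = I.encode.getD (Instance.slot I.n (i.eval σ) (j.eval σ)) 0 := by
  simp only [flagE, slotE, pairE, eval_get, eval_add, eval_mul, eval_const, eval_reg, h.zero]
  exact h _

theorem HasInput.eval_numE {I : Instance} {σ : State} (h : HasInput I σ) (i j : Expr) :
    (numE i j).eval σ = I.num (i.eval σ) (j.eval σ) := by
  simp only [numE, slotE, pairE, eval_get, eval_add, eval_mul, eval_const, eval_reg, h.zero]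
  exact h _

theorem HasInput.eval_denE {I : Instance} {σ : State} (h : HasInput I σ) (i j : Expr) :
    (denE i j).eval σ = I.den (i.eval σ) (j.eval σ) := by
  simp only [denE, slotE, pairE, eval_get, eval_add, eval_mul, eval_const, eval_reg, h.zero]
  exact h _

theorem HasInput.eval_weightE {I : Instance} {σ : State} (h : HasInput I σ)
    (h9 : σ 9 0 = I.scale) (i j : Expr) :
    (weightE i j).eval σ = I.W (i.eval σ) (j.eval σ) := by
  simp [weightE, h.eval_denE, h.eval_numE, h9, Instance.W]

/-- Compute the common denominator in register `9`. -/
def scaleProg : Prog :=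
  seq (setReg 9 (const 1)) <| .loop 7 <| .loop 8 <|
    ite (flagE (reg 7) (reg 8)) (setReg 9 (reg 9 * denE (reg 7) (reg 8))) skip

theorem scaleProg_spec {I : Instance} {σ : State} (h : HasInput I σ) :
    scaleProg.eval σ 9 0 = I.scale := by
  classical
  set σ₀ := (setReg 9 (const 1)).eval σ with hσ₀
  have h0 : HasInput I σ₀ := h.congr (by simp [hσ₀, State.write_of_ne])
  set f : ℕ → ℕ → ℕ := fun i j => if I.AdjN i j then I.den i j else 1 with hf
  have key := loop_induction (v := 7) (P := .loop 8 <|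
    ite (flagE (reg 7) (reg 8)) (setReg 9 (reg 9 * denE (reg 7) (reg 8))) skip) (σ := σ₀)
    (fun i τ => HasInput I τ ∧
      τ 9 0 = ∏ i' ∈ Finset.range i, ∏ j' ∈ Finset.range (I.n + 1), f i' j') ?_ ?_
  · rw [h0.zero] at key
    exact key.2
  · exact ⟨h0.congr (by simp [State.write_of_ne]), by simp [hσ₀, State.write_apply]⟩
  · rintro i hi τ hτi ⟨hin, hprod⟩
    have key := loop_induction (v := 8) (P := ite (flagE (reg 7) (reg 8))
      (setReg 9 (reg 9 * denE (reg 7) (reg 8))) skip) (σ := τ)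
      (fun j τ => HasInput I τ ∧ τ 7 0 = i ∧
      τ 9 0 = (∏ i' ∈ Finset.range i, ∏ j' ∈ Finset.range (I.n + 1), f i' j') *
        ∏ j' ∈ Finset.range j, f i j') ?_ ?_
    · obtain ⟨a1, a2, a3⟩ := key
      refine ⟨a1.congr (by simp [State.write_of_ne]), ?_⟩
      rw [hin.zero] at a3
      simp only [State.write_apply]
      norm_num
      rw [a3, Finset.prod_range_succ _ i]
    · exact ⟨hin.congr (by simp [State.write_of_ne]), by simp [State.write_apply, hτi],
        by simp [State.write_apply, hprod]⟩
    · rintro j hj τ hτj ⟨a1, a2, a3⟩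
      rw [eval_ite, a1.eval_flagE]
      simp only [eval_reg, hτj, a2]
      rw [h0.zero] at hi
      rw [hin.zero] at hj
      have hflag := I.flag_ne_zero_iff hi hj
      rw [Finset.prod_range_succ, ← mul_assoc, ← a3]
      split_ifs with hadj <;> rw [hflag] at hadj
      · refine ⟨a1.congr (by simp [State.write_of_ne]), by simp [State.write_apply, a2], ?_⟩
        simp [State.write_apply, a1.eval_denE, a2, hτj, hf, hadj]
      · refine ⟨a1.congr (by simp [State.write_of_ne]), by simp [State.write_apply, a2], ?_⟩
        simp [State.write_apply, hf, hadj]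

/-! ### Shortest walks by dynamic programming -/

/-- The recursion for the cell `(k + 1, i, j)` of the tables `D` of distances plus one (or `0` if
there is no walk with that number of steps) and `X` of first steps. -/
structure Relaxed (I : Instance) (D X : ℕ → ℕ) (k i j : ℕ) : Prop where
  le : ∀ w ≤ I.n, (w = i ∨ I.AdjN i w) → D (addr I.n k w j) ≠ 0 → D (addr I.n (k + 1) i j) ≠ 0 ∧
    D (addr I.n (k + 1) i j) ≤ I.W i w + D (addr I.n k w j)
  step : D (addr I.n (k + 1) i j) ≠ 0 → ∃ w ≤ I.n, X (addr I.n (k + 1) i j) = w ∧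
    (w = i ∨ I.AdjN i w) ∧ D (addr I.n k w j) ≠ 0 ∧
    D (addr I.n (k + 1) i j) = I.W i w + D (addr I.n k w j)

structure Tables (I : Instance) (D X : ℕ → ℕ) : Prop where
  zero : ∀ i ≤ I.n, ∀ j ≤ I.n, D (addr I.n 0 i j) = if i = j then 1 else 0
  relaxed : ∀ k ≤ I.n, ∀ i ≤ I.n, ∀ j ≤ I.n, Relaxed I D X k i j

/-- Layer `k` accounts for all walks with at most `k` edges: follow the walk edge by edge, and spend
surplus layers on free steps in place. -/
theorem Tables.ne_zero_and_le {I : Instance} {D X : ℕ → ℕ} (h : Tables I D X) {u v : Fin (I.n + 1)}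
    (p : I.G.Walk u v) : ∀ k, p.length ≤ k → k ≤ I.n + 1 →
      D (addr I.n k u v) ≠ 0 ∧ D (addr I.n k u v) ≤ wlen I.wt p + 1 := by
  induction p with
  | @nil u =>
    intro k
    induction k with
    | zero => intro _ _; rw [h.zero _ (by omega) _ (by omega)]; simp [wlen]
    | succ k ih =>
      intro _ hk
      obtain ⟨h1, h2⟩ := ih (by simp) (by omega)
      obtain ⟨h3, h4⟩ := (h.relaxed k (by omega) u (by omega) u (by omega)).le u (by omega)
        (Or.inl rfl) h1
      rw [I.W_self (by omega)] at h4
      exact ⟨h3, by omega⟩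
  | @cons u x v hadj p ih =>
    intro k hk hkn
    simp only [SimpleGraph.Walk.length_cons] at hk
    obtain ⟨k, rfl⟩ : ∃ k', k = k' + 1 := ⟨k - 1, by omega⟩
    obtain ⟨h1, h2⟩ := ih k (by omega) (by omega)
    obtain ⟨h3, h4⟩ := (h.relaxed k (by omega) u (by omega) v (by omega)).le x (by omega)
      (Or.inr ((I.adjN_iff _ _).2 hadj)) h1
    have : I.wt u x = I.W u x := rfl
    refine ⟨h3, ?_⟩
    simp only [wlen]
    omega

/-- Conversely, the recorded first steps assemble to a walk of exactly the stored weight, so entries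
never fall below the distance. -/
theorem Tables.exists_walk {I : Instance} {D X : ℕ → ℕ} (h : Tables I D X) :
    ∀ k ≤ I.n + 1, ∀ u v : Fin (I.n + 1), D (addr I.n k u v) ≠ 0 →
      ∃ p : I.G.Walk u v, wlen I.wt p + 1 = D (addr I.n k u v) := by
  intro k
  induction k with
  | zero =>
    intro _ u v
    rw [h.zero _ (by omega) _ (by omega)]
    split_ifs with huv
    · obtain rfl := Fin.ext huv
      exact fun _ => ⟨.nil, by simp [wlen]⟩
    · simp
  | succ k ih =>
    intro hk u v hD
    obtain ⟨w, hw, -, hadj, h1, h2⟩ :=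
      (h.relaxed k (by omega) u (by omega) v (by omega)).step hD
    obtain ⟨p, hp⟩ := ih (by omega) ⟨w, by omega⟩ v h1
    simp only at hp
    rcases hadj with rfl | hadj
    · rw [I.W_self (by omega)] at h2
      exact ⟨p, by omega⟩
    · obtain ⟨_, _, hadj⟩ := hadj
      refine ⟨.cons hadj p, ?_⟩
      have : I.wt u ⟨w, by omega⟩ = I.W u w := rfl
      simp only [wlen]
      omega

/-- A lightest walk can be shortened to at most n edges, so layer n + 1 suffices. -/
theorem Tables.eq_dist {I : Instance} {D X : ℕ → ℕ} (h : Tables I D X) {i j : ℕ} (hi : i ≤ I.n)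
    (hj : j ≤ I.n) : D (addr I.n (I.n + 1) i j) = I.dist i j + 1 := by
  have e := I.dist_val ⟨i, by omega⟩ ⟨j, by omega⟩
  simp only at e
  obtain ⟨p, hp⟩ := exists_wlen_eq_minLen I.wt I.connected ⟨i, by omega⟩ ⟨j, by omega⟩
  obtain ⟨q, hq, hqp⟩ := exists_short_walk I.wt p
  rw [Fintype.card_fin] at hq
  obtain ⟨h1, h2⟩ := h.ne_zero_and_le q (I.n + 1) (by omega) le_rfl
  obtain ⟨p', hp'⟩ := h.exists_walk (I.n + 1) le_rfl ⟨i, by omega⟩ ⟨j, by omega⟩ h1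
  have := minLen_le I.wt p'
  simp only at h1 h2 hp'
  omega

/-- Relax the cell `(reg 6 + 1, reg 7, reg 8)`. -/
def relaxProg : Prog :=
  seq (argmin ((flagE (reg 7) (reg 2) + Expr.eq (reg 2) (reg 7)) *
      get 10 (addrE (reg 6) (reg 2) (reg 8)))
    (weightE (reg 7) (reg 2) + get 10 (addrE (reg 6) (reg 2) (reg 8)))) <|
  seq (set 10 (addrE (reg 6 + const 1) (reg 7) (reg 8)) (reg 4))
    (set 11 (addrE (reg 6 + const 1) (reg 7) (reg 8)) (reg 3))

/-- Compute the distance tables in the arrays `10` and `11`. -/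
def tablesProg : Prog :=
  seq (.loop 7 <| .loop 8 <| set 10 (addrE (const 0) (reg 7) (reg 8)) (Expr.eq (reg 7) (reg 8))) <|
  .loop 6 <| .loop 7 <| .loop 8 relaxProg

theorem relaxProg_spec {I : Instance} {σ : State} (h : HasInput I σ) (h9 : σ 9 0 = I.scale)
    {k i j : ℕ} (hk : σ 6 0 = k) (hi : σ 7 0 = i) (hj : σ 8 0 = j) (hin : i ≤ I.n) (hjn : j ≤ I.n) :
    Relaxed I (relaxProg.eval σ 10) (relaxProg.eval σ 11) k i j ∧
      (∀ m, m ≠ addr I.n (k + 1) i j →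
        relaxProg.eval σ 10 m = σ 10 m ∧ relaxProg.eval σ 11 m = σ 11 m) ∧
      ∀ a ∉ [2, 3, 4, 5, 10, 11], relaxProg.eval σ a = σ a := by
  simp only [relaxProg, eval_seq]
  generalize hτ : (argmin _ _).eval σ = τ
  have hfr : ∀ a ∉ [2, 3, 4, 5], τ a = σ a := fun a ha => by rw [← hτ]; exact argmin_frame _ _ _ ha
  have hmin := argmin_spec
    (fun x => (I.encode.getD (Instance.slot I.n i x) 0 + if x = i then 1 else 0) *
      σ 10 (addr I.n k x j))
    (fun x => I.W i x + σ 10 (addr I.n k x j)) (fun ρ hρ => by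
      have hin := h.congr (hρ 0 (by decide))
      have h9' : ρ 9 0 = I.scale := by rw [hρ 9 (by decide), h9]
      simp only [eval_mul, eval_add, eval_get, eval_eq, hin.eval_flagE, hin.eval_weightE h9',
        hin.eval_addrE, eval_reg, hρ 6 (by decide), hρ 7 (by decide), hρ 8 (by decide),
        hρ 10 (by decide), hk, hi, hj]
      constructor <;> first | rfl | trivial) hτ
  rw [h.zero] at hmin
  have hτin : HasInput I τ := h.congr (hfr 0 (by decide))
  have e : (addrE (reg 6 + const 1) (reg 7) (reg 8)).eval τ = addr I.n (k + 1) i j := by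
    simp [hτin.eval_addrE, hfr, hk, hi, hj]
  have hτ' : HasInput I (τ.write 10 (addr I.n (k + 1) i j) (τ 4 0)) :=
    hτin.congr (by simp [State.write_of_ne])
  simp only [eval_set, e, eval_reg, hτ'.eval_addrE, eval_add, eval_const]
  simp only [State.write_apply, hfr 6 (by decide), hfr 7 (by decide), hfr 8 (by decide),
    hfr 10 (by decide), hfr 11 (by decide), hk, hi, hj]
  norm_num
  have hne : ∀ w ≤ I.n, addr I.n k w j ≠ addr I.n (k + 1) i j := by
    intro w hw
    rw [Ne, addr_inj hw hjn hin hjn]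
    omega
  have hguard : ∀ w ≤ I.n, (I.encode.getD (Instance.slot I.n i w) 0 + if w = i then 1 else 0) ≠ 0 ↔
      (w = i ∨ I.AdjN i w) := by
    intro w hw
    rw [← I.flag_ne_zero_iff hin hw]
    split_ifs with hwi <;> simp [hwi]
  refine ⟨⟨?_, ?_⟩, ?_, ?_⟩
  · intro w hw hadj hD
    simp only [State.write_apply, hfr 10 (by decide)] at hD ⊢
    norm_num at hD ⊢
    rw [if_neg (hne w hw)] at hD ⊢
    have hgw := (hguard w hw).2 hadj
    rcases hmin with ⟨-, -, -, h4⟩ | ⟨-, h2, h3, h4, h5⟩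
    · exact absurd (h4 w hw) (mul_ne_zero hgw hD)
    · refine ⟨?_, h5 w hw (mul_ne_zero hgw hD)⟩
      have := right_ne_zero_of_mul h3
      omega
  · intro hD
    simp only [State.write_apply, hfr 10 (by decide)] at hD ⊢
    norm_num at hD ⊢
    rcases hmin with ⟨-, -, h3, -⟩ | ⟨-, h2, h3, h4, h5⟩
    · exact absurd h3 hD
    · refine ⟨τ 3 0, h2, rfl, (hguard _ h2).1 (left_ne_zero_of_mul h3), ?_⟩
      rw [if_neg (hne _ h2)]
      exact ⟨right_ne_zero_of_mul h3, h4⟩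
  · intro m hm
    constructor <;> intro h' <;> exact absurd h' hm
  · intro a a2 a3 a4 a5 a10 a11
    simp [State.write_of_ne, a10, a11]
    exact hfr a (by simp [*])

/-- A cell of layer `k + 1` refers only to itself and to layer `k`, and the overwritten cell lies in
the later layer `k' + 1`; finished cells therefore stay correct. -/
theorem Relaxed.congr {I : Instance} {D X D' X' : ℕ → ℕ} {k i j : ℕ} (h : Relaxed I D X k i j)
    (hi : i ≤ I.n) (hj : j ≤ I.n) {k' i' j' : ℕ} (hi' : i' ≤ I.n) (hj' : j' ≤ I.n) (hk : k ≤ k')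
    (hne : ¬ (k = k' ∧ i = i' ∧ j = j'))
    (hD : ∀ m, m ≠ addr I.n (k' + 1) i' j' → D' m = D m ∧ X' m = X m) : Relaxed I D' X' k i j := by
  have h1 : ∀ w ≤ I.n, D' (addr I.n k w j) = D (addr I.n k w j) := by
    intro w hw
    refine (hD _ ?_).1
    rw [Ne, addr_inj hw hj hi' hj']
    omega
  have h2 := hD (addr I.n (k + 1) i j) (by rw [Ne, addr_inj hi hj hi' hj']; omega)
  constructor
  · intro w hw hadj hD
    rw [h2.1]
    rw [h1 w hw] at hD ⊢
    exact h.le w hw hadj hD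
  · rw [h2.1, h2.2]
    intro h0
    obtain ⟨w, hw, e1, e2, e3, e4⟩ := h.step h0
    exact ⟨w, hw, e1, e2, by rwa [h1 w hw], by rwa [h1 w hw]⟩

theorem tablesProg_init {I : Instance} {σ : State} (h : HasInput I σ) {τ : State}
    (hτ : (Prog.loop 7 <| .loop 8 <| set 10 (addrE (const 0) (reg 7) (reg 8))
      (Expr.eq (reg 7) (reg 8))).eval σ = τ) :
    ∀ i ≤ I.n, ∀ j ≤ I.n, τ 10 (addr I.n 0 i j) = if i = j then 1 else 0 := by
  have key := loop_induction (v := 7) (σ := σ) (P := .loop 8 <| set 10 (addrE (const 0) (reg 7)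
    (reg 8)) (Expr.eq (reg 7) (reg 8))) (fun i τ => HasInput I τ ∧ ∀ i' < i, i' ≤ I.n →
      ∀ j ≤ I.n, τ 10 (addr I.n 0 i' j) = if i' = j then 1 else 0) ?_ ?_
  · rw [hτ, h.zero] at key
    exact fun i hi j hj => key.2 i (by omega) hi j hj
  · exact ⟨h.congr (by simp [State.write_of_ne]), by simp⟩
  · rintro i hi ρ hρi ⟨hin, hinv⟩
    rw [h.zero] at hi
    have key := loop_induction (v := 8) (σ := ρ) (P := set 10 (addrE (const 0) (reg 7)
      (reg 8)) (Expr.eq (reg 7) (reg 8))) (fun j τ => HasInput I τ ∧ τ 7 0 = i ∧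
        (∀ i' < i, i' ≤ I.n → ∀ j ≤ I.n, τ 10 (addr I.n 0 i' j) = if i' = j then 1 else 0) ∧
        ∀ j' < j, j' ≤ I.n → τ 10 (addr I.n 0 i j') = if i = j' then 1 else 0) ?_ ?_
    · obtain ⟨a1, a2, a3, a4⟩ := key
      refine ⟨a1.congr (by simp [State.write_of_ne]), fun i' hi' hi'n j hj => ?_⟩
      rw [State.write_of_ne _ _ _ (by decide)]
      rw [hin.zero] at a4
      rcases Nat.lt_or_eq_of_le (Nat.lt_succ_iff.1 hi') with h' | rfl
      · exact a3 i' h' hi'n j hj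
      · exact a4 j (by omega) hj
    · refine ⟨hin.congr (by simp [State.write_of_ne]), by simp [State.write_apply, hρi], ?_, by simp⟩
      simpa [State.write_of_ne] using hinv
    · rintro j hj ρ' hρj ⟨a1, a2, a3, a4⟩
      rw [hin.zero] at hj
      simp only [eval_set, a1.eval_addrE, eval_const, eval_reg, eval_eq, a2, hρj]
      refine ⟨a1.congr (by simp [State.write_of_ne]), by simp [State.write_apply, a2], ?_, ?_⟩
      · intro i' hi' hi'n j' hj'
        rw [State.write_of_ne _ _ _ (by decide), State.write_apply, if_neg]
        · exact a3 i' hi' hi'n j' hj'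
        · rw [addr_inj hi'n hj' hi hj]
          omega
      · intro j' hj' hj'n
        rw [State.write_of_ne _ _ _ (by decide), State.write_apply]
        by_cases hjj : j' = j
        · subst hjj; simp
        · rw [if_neg (by rw [addr_inj hi hj'n hi hj]; omega)]
          exact a4 j' (by omega) hj'n

theorem tablesProg_spec {I : Instance} {σ : State} (h : HasInput I σ) (h9 : σ 9 0 = I.scale) :
    Tables I (tablesProg.eval σ 10) (tablesProg.eval σ 11) := by
  simp only [tablesProg, eval_seq]
  generalize hτ : (Prog.loop 7 _).eval σ = τ
  have hz := tablesProg_init h hτ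
  have hτ0 : HasInput I τ := h.congr (by
    rw [← hτ]; exact eval_of_not_mem_writes _ _ (by simp [writes]))
  have hτ9 : τ 9 0 = I.scale := by
    rw [← h9, ← hτ, eval_of_not_mem_writes _ _ (by simp [writes])]
  -- The three nested loops process the cells in lexicographic order; `done` says that the second
  -- triple comes before the first.
  set done : ℕ → ℕ → ℕ → ℕ → ℕ → ℕ → Prop := fun k i j k' i' j' =>
    k' < k ∨ k' = k ∧ (i' < i ∨ i' = i ∧ j' < j) with hdone
  set Inv : ℕ → ℕ → ℕ → State → Prop := fun k i j ρ => HasInput I ρ ∧ ρ 9 0 = I.scale ∧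
    (∀ i ≤ I.n, ∀ j ≤ I.n, ρ 10 (addr I.n 0 i j) = if i = j then 1 else 0) ∧
    ∀ k' ≤ I.n, ∀ i' ≤ I.n, ∀ j' ≤ I.n, done k i j k' i' j' → Relaxed I (ρ 10) (ρ 11) k' i' j'
    with hInv
  have hmono : ∀ {k i j k₁ i₁ j₁ : ℕ} {ρ ρ' : State}, Inv k i j ρ →
      (∀ a, a ≠ 6 → a ≠ 7 → a ≠ 8 → ρ' a = ρ a) →
      (∀ k' ≤ I.n, ∀ i' ≤ I.n, ∀ j' ≤ I.n, done k₁ i₁ j₁ k' i' j' → done k i j k' i' j') →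
      Inv k₁ i₁ j₁ ρ' := by
    rintro k i j k₁ i₁ j₁ ρ ρ' ⟨a1, a2, a3, a4⟩ hfr hd
    simp only [hInv]
    rw [hfr 10 (by decide) (by decide) (by decide), hfr 11 (by decide) (by decide) (by decide),
      hfr 9 (by decide) (by decide) (by decide)]
    exact ⟨a1.congr (hfr 0 (by decide) (by decide) (by decide)), a2, a3,
      fun k' hk' i' hi' j' hj' h' => a4 k' hk' i' hi' j' hj' (hd k' hk' i' hi' j' hj' h')⟩
  have key := loop_induction (v := 6) (σ := τ) (P := .loop 7 <| .loop 8 relaxProg)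
    (fun k ρ => Inv k 0 0 ρ) ?_ ?_
  · obtain ⟨-, -, a3, a4⟩ := key
    rw [hτ0.zero] at a4
    exact ⟨a3, fun k hk i hi j hj => a4 k hk i hi j hj (Or.inl (by omega))⟩
  · have : Inv 0 0 0 τ := ⟨hτ0, hτ9, hz, by simp [hdone]⟩
    exact hmono this (fun a h6 _ _ => State.write_of_ne _ _ _ h6) fun _ _ _ _ _ _ h' => h'
  intro k hk ρ hρ hinv
  rw [hτ0.zero] at hk
  have key := loop_induction (v := 7) (σ := ρ) (P := .loop 8 relaxProg)
    (fun i ρ => ρ 6 0 = k ∧ Inv k i 0 ρ) ?_ ?_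
  · refine hmono key.2 (fun a h6 _ _ => State.write_of_ne _ _ _ h6) ?_
    rw [hinv.1.zero]
    simp only [hdone]
    omega
  · exact ⟨by simp [State.write_apply, hρ],
      hmono hinv (fun a _ h6 _ => State.write_of_ne _ _ _ h6) fun _ _ _ _ _ _ h' => h'⟩
  rintro i hi ρ₁ hρi ⟨hρ6, hinv₁⟩
  rw [hinv.1.zero] at hi
  have key := loop_induction (v := 8) (σ := ρ₁) (P := relaxProg)
    (fun j ρ => ρ 6 0 = k ∧ ρ 7 0 = i ∧ Inv k i j ρ) ?_ ?_
  · refine ⟨by simp [State.write_apply, key.1],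
      hmono key.2.2 (fun a _ h6 _ => State.write_of_ne _ _ _ h6) ?_⟩
    rw [hinv₁.1.zero]
    simp only [hdone]
    omega
  · exact ⟨by simp [State.write_apply, hρ6], by simp [State.write_apply, hρi],
      hmono hinv₁ (fun a _ _ h6 => State.write_of_ne _ _ _ h6) fun _ _ _ _ _ _ h' => h'⟩
  rintro j hj ρ₂ hρj ⟨h6, h7, a1, a2, a3, a4⟩
  rw [hinv₁.1.zero] at hj
  obtain ⟨b1, b2, b3⟩ := relaxProg_spec a1 a2 h6 h7 hρj hi hj
  refine ⟨by simp [State.write_apply, b3, h6], by simp [State.write_apply, b3, h7], ?_⟩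
  have : Inv k i (j + 1) (relaxProg.eval ρ₂) := by
    refine ⟨a1.congr (b3 0 (by decide)), by rw [b3 9 (by decide), a2], fun i' hi' j' hj' => ?_,
      fun k' hk' i' hi' j' hj' hd => ?_⟩
    · rw [(b2 _ _).1]
      · exact a3 i' hi' j' hj'
      · rw [Ne, addr_inj hi' hj' hi hj]; omega
    · by_cases heq : k' = k ∧ i' = i ∧ j' = j
      · obtain ⟨rfl, rfl, rfl⟩ := heq
        exact b1
      · simp only [hdone] at hd
        refine (a4 k' hk' i' hi' j' hj' ?_).congr hi' hj' hi hj (by omega) heq b2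
        simp only [hdone]
        omega
  exact hmono this (fun a _ _ h6 => State.write_of_ne _ _ _ h6) fun _ _ _ _ _ _ h' => h'

end RFTT

namespace RFTT

open RAM RAM.Prog RAM.Expr

theorem writes_argmin (g key : Expr) : (argmin g key).writes = [3, 4, 5, 2, 4, 3, 5] := rfl

theorem writes_setReg (a : ℕ) (e : Expr) : (setReg a e).writes = [a] := rfl

/-- The memory holds the instance and its distance tables. -/
structure Ready (I : Instance) (σ : State) : Prop where
  input : HasInput I σ
  tables : Tables I (σ 10) (σ 11)

theorem Ready.congr {I : Instance} {σ τ : State} (h : Ready I σ) (h0 : τ 0 = σ 0)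
    (h10 : τ 10 = σ 10) (h11 : τ 11 = σ 11) : Ready I τ :=
  ⟨h.input.congr h0, by rw [h10, h11]; exact h.tables⟩

/-! ### Growing the tree of a class -/

/-- Nonzero if and only if the vertex `x` belongs to the class with `2 ^ c = reg 30`. -/
def classE (x : Expr) : Expr :=
  x * ((get 0 x - (get 0 x - reg 0)) + const 1 - reg 30) *
    (reg 30 + reg 30 - (get 0 x - (get 0 x - reg 0)))

/-- Truncated subtraction turns inequalities into nonzero tests, and `a - (a - n)` is the minimum of
`a` and `n`. Turnover times sit in the input at the index of their vertex; the factor `x` excludes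
the depot, where the input holds n. -/
theorem eval_classE_ne_zero {I : Instance} {σ : State} (h : HasInput I σ) {c : ℕ}
    (hc : σ 30 0 = 2 ^ c) {x : Expr} (hx : x.eval σ ≤ I.n) :
    (classE x).eval σ ≠ 0 ↔ x.eval σ ∈ I.classOf c := by
  have ht : σ 0 (x.eval σ) = I.tau (x.eval σ) := h _
  simp only [classE, eval_mul, eval_add, eval_sub, eval_get, eval_reg, eval_const, h.zero, hc, ht,
    Instance.classOf, Set.mem_ofPred_eq, pow_succ, mul_ne_zero_iff]
  omega

/-- Shift the positions (array `21`) beyond `reg 26` by twice `reg 27`. -/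
def shiftProg : Prog :=
  .loop 7 <| ite (get 21 (reg 7) - reg 26)
    (set 21 (reg 7) (get 21 (reg 7) + (reg 27 + reg 27))) skip

theorem shiftProg_spec {I : Instance} {σ : State} (h : HasInput I σ) {w : ℕ} (hw : w ≤ I.n) :
    shiftProg.eval σ 21 w =
      if σ 26 0 < σ 21 w then σ 21 w + 2 * σ 27 0 else σ 21 w := by
  have key := loop_induction (v := 7) (σ := σ) (P := ite (get 21 (reg 7) - reg 26)
    (set 21 (reg 7) (get 21 (reg 7) + (reg 27 + reg 27))) skip)
    (fun i τ => τ 26 = σ 26 ∧ τ 27 = σ 27 ∧ ∀ w, τ 21 w =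
      if w < i ∧ σ 26 0 < σ 21 w then σ 21 w + 2 * σ 27 0 else σ 21 w) ?_ ?_
  · rw [h.zero] at key
    have h1 : w < I.n + 1 := by omega
    exact (key.2.2 w).trans (by simp only [h1, true_and])
  · simp [State.write_of_ne]
  · rintro i hi τ hτi ⟨a1, a2, a3⟩
    rw [eval_ite]
    simp only [eval_sub, eval_get, eval_reg, hτi, a1, a3 i, lt_irrefl, false_and, if_false]
    split_ifs with hc
    · refine ⟨by simp [State.write_of_ne, a1], by simp [State.write_of_ne, a2], fun w => ?_⟩
      simp only [eval_set, eval_add, eval_get, eval_reg, hτi, a2, a3 i, lt_irrefl, false_and,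
        if_false]
      rw [State.write_of_ne _ _ _ (by decide), State.write_apply]
      by_cases hwi : w = i
      · subst hwi
        rw [if_pos ⟨rfl, rfl⟩, if_pos ⟨by omega, by omega⟩]
        ring
      · rw [if_neg (by omega), a3 w]
        have : w < i + 1 ↔ w < i := by omega
        simp only [this]
    · refine ⟨by simp [State.write_of_ne, a1], by simp [State.write_of_ne, a2], fun w => ?_⟩
      rw [eval_skip, State.write_of_ne _ _ _ (by decide), a3 w]
      by_cases hwi : w = i
      · subst hwi
        rw [if_neg (by omega), if_neg (by omega)]
      · have : w < i + 1 ↔ w < i := by omega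
        simp only [this]

/-- For every vertex, find the closest vertex of the tree and the distance plus one. -/
def nearProg : Prog :=
  .loop 7 <| seq (argmin (get 20 (reg 2)) (get 10 (addrE (reg 0 + const 1) (reg 2) (reg 7)))) <|
    seq (set 23 (reg 7) (reg 3)) (set 24 (reg 7) (reg 4))

theorem nearProg_spec {I : Instance} {σ : State} (h : Ready I σ) {A : Finset ℕ} (hA0 : 0 ∈ A)
    (hA : ∀ v ≤ I.n, σ 20 v = if v ∈ A then 1 else 0) {v : ℕ} (hv : v ≤ I.n) :
    nearProg.eval σ 23 v ≤ I.n ∧ nearProg.eval σ 23 v ∈ A ∧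
    nearProg.eval σ 24 v = I.dist (nearProg.eval σ 23 v) v + 1 ∧
    ∀ u ∈ A, u ≤ I.n → nearProg.eval σ 24 v ≤ I.dist u v + 1 := by
  set Good : State → ℕ → Prop := fun τ v => τ 23 v ≤ I.n ∧ τ 23 v ∈ A ∧
    τ 24 v = I.dist (τ 23 v) v + 1 ∧ ∀ u ∈ A, u ≤ I.n → τ 24 v ≤ I.dist u v + 1 with hGood
  have key := loop_induction (v := 7) (σ := σ) (P := seq (argmin (get 20 (reg 2))
    (get 10 (addrE (reg 0 + const 1) (reg 2) (reg 7)))) <|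
    seq (set 23 (reg 7) (reg 3)) (set 24 (reg 7) (reg 4)))
    (fun i τ => (∀ a ∈ [0, 10, 11, 20], τ a = σ a) ∧ ∀ v < i, Good τ v) ?_ ?_
  · rw [h.input.zero] at key
    exact key.2 v (by omega)
  · exact ⟨by simp [State.write_of_ne], by simp⟩
  · rintro i hi τ hτi ⟨a1, a2⟩
    rw [h.input.zero] at hi
    have hR : Ready I τ := h.congr (a1 _ (by decide)) (a1 _ (by decide)) (a1 _ (by decide))
    simp only [eval_seq]
    generalize hρ : (argmin _ _).eval τ = ρ
    have hfr : ∀ a ∉ [2, 3, 4, 5], ρ a = τ a :=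
      fun a ha => by rw [← hρ]; exact argmin_frame _ _ _ ha
    have hmin := argmin_spec (fun x => σ 20 x) (fun x => σ 10 (addr I.n (I.n + 1) x i))
      (fun ρ' hρ' => by
        have hin := hR.input.congr (hρ' 0 (by decide))
        simp only [eval_get, hin.eval_addrE, eval_reg, eval_add, eval_const, hin.zero,
          hρ' 7 (by decide), hρ' 20 (by decide), hρ' 10 (by decide), hτi, a1 20 (by decide),
          a1 10 (by decide)]
        constructor <;> first | rfl | trivial) hρ
    rw [hR.input.zero] at hmin
    simp only [eval_set, eval_reg]
    refine ⟨fun a ha => ?_, fun v hv => ?_⟩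
    · rw [← a1 a ha]
      simp at ha
      rcases ha with rfl | rfl | rfl | rfl <;> simp [State.write_of_ne, hfr]
    · simp only [hGood, State.write_apply, hfr 7 (by decide), hτi]
      norm_num
      by_cases hvi : v = i
      · subst hvi
        simp only [if_true]
        rcases hmin with ⟨-, -, -, h4⟩ | ⟨-, h2, h3, h4, h5⟩
        · have := h4 0 (by omega)
          rw [hA 0 (by omega), if_pos hA0] at this
          omega
        · rw [hA _ h2] at h3
          have h3 : ρ 3 0 ∈ A := by by_contra hcon; simp [hcon] at h3
          rw [h.tables.eq_dist h2 hi] at h4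
          refine ⟨h2, h3, h4, fun u hu hun => ?_⟩
          rw [← h.tables.eq_dist hun hi]
          exact h5 u hun (by rw [hA u hun, if_pos hu]; omega)
      · simp only [hvi, if_false]
        rw [hfr 23 (by decide), hfr 24 (by decide)]
        exact a2 v (by omega)

/-- Attach the vertex `reg 3` to the tree. -/
def attachProg : Prog :=
  seq (setReg 28 (reg 3)) <| seq (setReg 25 (get 23 (reg 28))) <|
  seq (setReg 27 (get 24 (reg 28) - const 1)) <| seq (setReg 26 (get 21 (reg 25))) <|
  seq shiftProg <| seq (set 21 (reg 28) (reg 26 + reg 27)) <|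
  seq (set 20 (reg 28) (const 1)) <| setReg 22 (reg 22 + (reg 27 + reg 27))

/-- On the line this inserts a detour from `u` to `v` and back: a gap of length `2 * d` opens right
after the position of `u`, with `v` in its middle. -/
theorem attachProg_spec {I : Instance} {σ : State} (h : HasInput I σ) {u v d : ℕ} (hv : σ 3 0 = v)
    (hu : σ 23 v = u) (hd : σ 24 v - 1 = d) :
    (∀ w, attachProg.eval σ 20 w = if w = v then 1 else σ 20 w) ∧
    attachProg.eval σ 22 0 = σ 22 0 + 2 * d ∧
    ∀ w ≤ I.n, attachProg.eval σ 21 w = if w = v then σ 21 u + d else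
      if σ 21 u < σ 21 w then σ 21 w + 2 * d else σ 21 w := by
  simp only [attachProg, eval_seq, eval_setReg, eval_reg]
  set σ₁ : State := (((σ.write 28 0 (σ 3 0)).write 25 0 _).write 27 0 _).write 26 0 _ with hσ₁
  have e28 : σ₁ 28 0 = v := by simp [hσ₁, State.write_apply, hv]
  have e27 : σ₁ 27 0 = d := by simp [hσ₁, State.write_apply, hv, hd]
  have e26 : σ₁ 26 0 = σ 21 u := by simp [hσ₁, State.write_apply, hv, hu]
  have e21 : σ₁ 21 = σ 21 := by simp [hσ₁, State.write_of_ne]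
  have hin : HasInput I σ₁ := h.congr (by simp [hσ₁, State.write_of_ne])
  have hsh := fun (w : ℕ) (hw : w ≤ I.n) => shiftProg_spec hin hw
  have hfr : ∀ a, a ≠ 7 → a ≠ 21 → shiftProg.eval σ₁ a = σ₁ a := fun a h1 h2 =>
    eval_of_not_mem_writes _ _ (by simp [shiftProg, writes, h1, h2])
  generalize shiftProg.eval σ₁ = τ at *
  have f28 : τ 28 0 = v := by rw [hfr 28 (by decide) (by decide), e28]
  have f27 : τ 27 0 = d := by rw [hfr 27 (by decide) (by decide), e27]
  have f26 : τ 26 0 = σ 21 u := by rw [hfr 26 (by decide) (by decide), e26]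
  have f20 : τ 20 = σ 20 := by
    rw [hfr 20 (by decide) (by decide)]; simp [hσ₁, State.write_of_ne]
  have f22 : τ 22 = σ 22 := by
    rw [hfr 22 (by decide) (by decide)]; simp [hσ₁, State.write_of_ne]
  refine ⟨fun w => ?_, ?_, fun w hw => ?_⟩
  · simp [State.write_apply, f28, f20]
  · simp [State.write_apply, f27, f22]; ring
  · simp only [State.write_apply, eval_set, eval_reg, eval_add, eval_const]
    norm_num
    rw [f28, f26, f27, hsh w hw, e26, e27, e21]

/-- Attach one more vertex of the class to the tree. -/
def primStepProg : Prog :=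
  seq nearProg <| seq (argmin (classE (reg 2) * (const 1 - get 20 (reg 2))) (get 24 (reg 2))) <|
    ite (reg 5) attachProg skip

/-- The array `20` marks the vertex set `A` of the tree, the array `21` holds positions of its
vertices on a line whose distances are not smaller than those in the graph, and register `22` is the
length of a line segment containing them. -/
structure TreeState (I : Instance) (c : ℕ) (σ : State) (A : Finset ℕ) (t : ℕ) : Prop where
  run : PrimRun I.dist 0 (I.classOf c) A t
  marks : ∀ v ≤ I.n, σ 20 v = if v ∈ A then 1 else 0
  total : σ 22 0 = 2 * t
  pos_le : ∀ v ∈ A, σ 21 v ≤ 2 * t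
  dist_le : ∀ v ∈ A, ∀ w ∈ A, σ 21 v ≤ σ 21 w → I.dist v w + σ 21 v ≤ σ 21 w

theorem TreeState.congr {I : Instance} {c : ℕ} {σ τ : State} {A : Finset ℕ} {t : ℕ}
    (h : TreeState I c σ A t) (h0 : τ 20 = σ 20) (h1 : τ 21 = σ 21) (h2 : τ 22 = σ 22) :
    TreeState I c τ A t :=
  ⟨h.run, by rw [h0]; exact h.marks, by rw [h2]; exact h.total, by rw [h1]; exact h.pos_le,
    by rw [h1]; exact h.dist_le⟩

theorem TreeState.mem_le {I : Instance} {c : ℕ} {σ : State} {A : Finset ℕ} {t : ℕ}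
    (h : TreeState I c σ A t) {v : ℕ} (hv : v ∈ A) : v ≤ I.n := by
  have := Instance.PrimRun.subset h.run (n := I.n) (fun v hv => hv.2.1) hv
  simp at this
  omega

/-- Opening the gap keeps the order of the old positions and only increases their differences. The
new vertex has line distance at least `d` plus the old line distance from `u` to every tree vertex
on either side, so the triangle inequality through `u` gives `dist_le`. -/
theorem primStepProg_spec {I : Instance} {c : ℕ} {σ : State} {A : Finset ℕ} {t : ℕ}
    (h : Ready I σ) (hc : σ 30 0 = 2 ^ c) (hT : TreeState I c σ A t) :
    (I.classOf c ⊆ A ∧ TreeState I c (primStepProg.eval σ) A t) ∨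
    ∃ A' t', ¬ I.classOf c ⊆ A ∧ A'.card = A.card + 1 ∧ TreeState I c (primStepProg.eval σ) A' t' := by
  have hnear := fun (v : ℕ) (hv : v ≤ I.n) => nearProg_spec h hT.run.root_mem hT.marks hv
  have hfr : ∀ a ∉ [2, 3, 4, 5, 7, 23, 24], nearProg.eval σ a = σ a := fun a ha =>
    eval_of_not_mem_writes _ _ (by simp [nearProg, writes, writes_argmin] at ha ⊢; omega)
  simp only [primStepProg, eval_seq, eval_ite]
  generalize nearProg.eval σ = τ at *
  have hin : HasInput I τ := h.input.congr (hfr 0 (by decide))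
  generalize hρ : (argmin _ _).eval τ = ρ
  have hfr' : ∀ a ∉ [2, 3, 4, 5], ρ a = τ a :=
    fun a ha => by rw [← hρ]; exact argmin_frame _ _ _ ha
  have hmin := argmin_spec
    (fun x => (classE (const x)).eval σ * (1 - σ 20 x)) (fun x => τ 24 x)
    (fun ρ' hρ' => by
      simp only [eval_mul, eval_sub, eval_get, eval_reg, eval_const, classE, eval_add,
        hρ' 0 (by decide), hρ' 20 (by decide), hρ' 24 (by decide), hρ' 30 (by decide),
        hfr 0 (by decide), hfr 20 (by decide), hfr 30 (by decide)]
      constructor <;> first | rfl | trivial) hρ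
  rw [hin.zero] at hmin
  have hguard : ∀ x ≤ I.n, (classE (const x)).eval σ * (1 - σ 20 x) ≠ 0 ↔
      x ∈ I.classOf c ∧ x ∉ A := by
    intro x hx
    rw [mul_ne_zero_iff, eval_classE_ne_zero h.input hc (by simpa using hx), hT.marks x hx]
    by_cases hxA : x ∈ A <;> simp [hxA]
  rcases hmin with ⟨h1, -, -, h4⟩ | ⟨h1, h2, h3, h4, h5⟩
  · left
    rw [if_neg (by simp [h1])]
    refine ⟨fun v hv => ?_, hT.congr ?_ ?_ ?_⟩
    · by_contra hcon
      exact (hguard v hv.2.1).2 ⟨hv, hcon⟩ (h4 v hv.2.1)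
    all_goals rw [eval_skip, hfr' _ (by decide), hfr _ (by decide)]
  · right
    rw [if_pos (by simp [h1])]
    set v := ρ 3 0 with hv
    obtain ⟨hvC, hvA⟩ := (hguard v h2).1 h3
    obtain ⟨n1, n2, n3, n4⟩ := hnear v h2
    set u := τ 23 v with hu
    obtain ⟨b1, b2, b3⟩ := attachProg_spec (hin.congr (hfr' 0 (by decide))) (u := u)
      (d := I.dist u v) hv.symm (by rw [hfr' 23 (by decide)])
      (by rw [hfr' 24 (by decide), n3]; omega)
    rw [hfr' 20 (by decide), hfr 20 (by decide)] at b1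
    rw [hfr' 22 (by decide), hfr 22 (by decide), hT.total] at b2
    rw [hfr' 21 (by decide), hfr 21 (by decide)] at b3
    have b4 : ∀ w ∈ A, attachProg.eval ρ 21 w =
        if σ 21 u < σ 21 w then σ 21 w + 2 * I.dist u v else σ 21 w := fun w hw => by
      rw [b3 w (hT.mem_le hw), if_neg (by rintro rfl; exact hvA hw)]
    refine ⟨insert v A, t + I.dist u v, fun hs => hvA (hs hvC), Finset.card_insert_of_notMem hvA, ?_, ?_, ?_, ?_, ?_⟩
    · refine hT.run.step n2 hvC hvA fun u' hu' v' hv' hv'A => ?_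
      have e1 := h5 v' hv'.2.1 ((hguard v' hv'.2.1).2 ⟨hv', hv'A⟩)
      have e2 := (hnear v' hv'.2.1).2.2.2 u' hu' (hT.mem_le hu')
      omega
    · intro w hw
      rw [b1, hT.marks w hw]
      by_cases hwv : w = v <;> simp [hwv]
    · rw [b2]; ring
    · intro w hw
      rcases Finset.mem_insert.1 hw with rfl | hwA
      · rw [b3 _ h2, if_pos rfl]
        have := hT.pos_le u n2
        omega
      · rw [b4 w hwA]
        have := hT.pos_le w hwA
        split_ifs <;> omega
    · intro w hw x hx
      rcases Finset.mem_insert.1 hw with rfl | hwA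
      · rw [b3 _ h2, if_pos rfl]
        rcases Finset.mem_insert.1 hx with rfl | hxA
        · simp [b3 _ h2, I.dist_self]
        · rw [b4 x hxA]
          have e1 := hT.dist_le u n2 x hxA
          have e2 := hT.dist_le x hxA u n2
          have e3 := I.dist_triangle (i := v) (k := x) n1
          rw [I.dist_comm v u] at e3
          rw [I.dist_comm x u] at e2
          split_ifs with hlt <;> intro hle <;> omega
      · rw [b4 w hwA]
        rcases Finset.mem_insert.1 hx with rfl | hxA
        · rw [b3 _ h2, if_pos rfl]
          have e1 := hT.dist_le u n2 w hwA
          have e2 := hT.dist_le w hwA u n2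
          have e3 := I.dist_triangle (i := w) (k := v) n1
          rw [I.dist_comm u w] at e1
          split_ifs with hlt <;> intro hle <;> omega
        · rw [b4 x hxA]
          have e1 := hT.dist_le w hwA x hxA
          split_ifs <;> intro hle <;> omega

/-- Grow the tree of the class with `2 ^ c = reg 30`. -/
def primProg : Prog :=
  seq (setReg 22 (const 0)) <|
  seq (.loop 7 <| seq (set 20 (reg 7) (Expr.eq (reg 7) (const 0))) (set 21 (reg 7) (const 0))) <|
  .loop 12 primStepProg

/-- Each of the n + 1 rounds adds a vertex unless the class is exhausted; n + 2 vertices are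
impossible. -/
theorem primProg_spec {I : Instance} {c : ℕ} {σ : State} (h : Ready I σ) (hc : σ 30 0 = 2 ^ c) :
    ∃ (A : Finset ℕ) (t : ℕ), I.classOf c ⊆ A ∧ TreeState I c (primProg.eval σ) A t := by
  simp only [primProg, eval_seq, eval_setReg, eval_const]
  set σ₀ := σ.write 22 0 0 with hσ₀
  have hin : HasInput I σ₀ := h.input.congr (by simp [hσ₀, State.write_of_ne])
  have key := loop_induction (v := 7) (σ := σ₀) (P := seq (set 20 (reg 7)
    (Expr.eq (reg 7) (const 0))) (set 21 (reg 7) (const 0)))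
    (fun i τ => ∀ v < i, (τ 20 v = if v = 0 then 1 else 0) ∧ τ 21 v = 0) (by simp) (by
      intro i hi τ hτi hinv v hv
      simp only [eval_seq, eval_set, eval_reg, eval_eq, eval_const, State.write_apply, hτi]
      norm_num
      by_cases hvi : v = i
      · subst hvi; simp
      · simpa [hvi] using hinv v (by omega))
  rw [hin.zero] at key
  have hfr : ∀ a ∉ [7, 20, 21], (Prog.loop 7 <| seq (set 20 (reg 7) (Expr.eq (reg 7) (const 0)))
      (set 21 (reg 7) (const 0))).eval σ₀ a = σ₀ a := fun a ha =>
    eval_of_not_mem_writes _ _ (by simp [writes] at ha ⊢; omega)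
  generalize (Prog.loop 7 _).eval σ₀ = τ at *
  have hR : Ready I τ := h.congr (by rw [hfr 0 (by decide)]; simp [hσ₀, State.write_of_ne])
    (by rw [hfr 10 (by decide)]; simp [hσ₀, State.write_of_ne])
    (by rw [hfr 11 (by decide)]; simp [hσ₀, State.write_of_ne])
  have hτc : τ 30 0 = 2 ^ c := by rw [hfr 30 (by decide)]; simp [hσ₀, State.write_of_ne, hc]
  have hT0 : TreeState I c τ {0} 0 := by
    refine ⟨.init, fun v hv => by rw [(key v (by omega)).1]; simp, ?_, ?_, ?_⟩
    · rw [hfr 22 (by decide)]; simp [hσ₀, State.write_apply]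
    · intro v hv
      rw [Finset.mem_singleton.1 hv, (key 0 (by omega)).2]
    · intro v hv w hw
      rw [Finset.mem_singleton.1 hv, Finset.mem_singleton.1 hw, I.dist_self]
      omega
  have hloop := loop_induction (v := 12) (σ := τ) (P := primStepProg)
    (fun r ρ => (∀ a ∈ [0, 10, 11, 30], ρ a = τ a) ∧
      ∃ A t, TreeState I c ρ A t ∧ (r + 1 ≤ A.card ∨ I.classOf c ⊆ A)) ?_ ?_
  · obtain ⟨-, A, t, hT, hA⟩ := hloop
    refine ⟨A, t, ?_, hT⟩
    rw [hR.input.zero] at hA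
    rcases hA with hA | hA
    · have : A.card ≤ I.n + 1 := by
        simpa using Finset.card_le_card (Instance.PrimRun.subset hT.run (n := I.n)
          fun v hv => hv.2.1)
      omega
    · exact hA
  · exact ⟨by simp [State.write_of_ne], {0}, 0, hT0.congr (by simp [State.write_of_ne])
      (by simp [State.write_of_ne]) (by simp [State.write_of_ne]), Or.inl (by simp)⟩
  · rintro r - ρ - ⟨a1, A, t, hT, hA⟩
    have hρR : Ready I ρ := hR.congr (a1 _ (by decide)) (a1 _ (by decide)) (a1 _ (by decide))
    refine ⟨fun a ha => ?_, ?_⟩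
    · rw [← a1 a ha, State.write_of_ne _ _ _ (by simp at ha; omega)]
      refine eval_of_not_mem_writes _ _ ?_
      simp [primStepProg, nearProg, attachProg, shiftProg, writes, writes_argmin,
        writes_setReg] at ha ⊢
      omega
    · rcases primStepProg_spec hρR (by rw [a1 30 (by decide), hτc]) hT with
        ⟨h1, h2⟩ | ⟨A', t', h0, h1, h2⟩
      · exact ⟨A, t, h2.congr (by simp [State.write_of_ne]) (by simp [State.write_of_ne])
          (by simp [State.write_of_ne]), Or.inr h1⟩
      · refine ⟨A', t', h2.congr (by simp [State.write_of_ne]) (by simp [State.write_of_ne])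
          (by simp [State.write_of_ne]), ?_⟩
        rcases hA with hA | hA
        · left; omega
        · exact absurd hA h0

end RFTT

namespace RFTT

open RAM RAM.Prog RAM.Expr

/-! ### Writing tours -/

/-- The list `l` is stored in `f` from the address `s` on. -/
def Seg (f : ℕ → ℕ) (s : ℕ) (l : List ℕ) : Prop := ∀ i < l.length, f (s + i) = l.getD i 0

theorem seg_nil (f : ℕ → ℕ) (s : ℕ) : Seg f s [] := by simp [Seg]

theorem seg_cons {f : ℕ → ℕ} {s a : ℕ} {l : List ℕ} :
    Seg f s (a :: l) ↔ f s = a ∧ Seg f (s + 1) l := by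
  constructor
  · intro h
    refine ⟨by simpa using h 0 (by simp), fun i hi => ?_⟩
    have := h (i + 1) (by simpa using hi)
    rw [List.getD_cons_succ] at this
    rw [← this]
    congr 1
    omega
  · rintro ⟨h1, h2⟩ i hi
    cases i with
    | zero => simpa using h1
    | succ i =>
      have := h2 i (by simpa using hi)
      rw [List.getD_cons_succ, ← this]
      congr 1
      omega

theorem seg_append {f : ℕ → ℕ} {s : ℕ} {l m : List ℕ} :
    Seg f s (l ++ m) ↔ Seg f s l ∧ Seg f (s + l.length) m := by
  induction l generalizing s with
  | nil => simp [seg_nil]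
  | cons a l ih =>
    simp only [List.cons_append, seg_cons, ih, List.length_cons, and_assoc]
    rw [show s + 1 + l.length = s + (l.length + 1) by omega]

theorem Seg.congr {f g : ℕ → ℕ} {s : ℕ} {l : List ℕ} (h : Seg f s l)
    (hg : ∀ i, s ≤ i → i < s + l.length → g i = f i) : Seg g s l := fun i hi => by
  rw [hg _ (by omega) (by omega), h i hi]

/-- Array `1` holds `H`, followed by the length of `l` and by `l`; the register `32` points to
the end and the register `33` to the length. -/
structure Writing (σ : State) (H l : List ℕ) : Prop where
  seg : Seg (σ 1) 0 (H ++ l.length :: l)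
  ptr : σ 32 0 = H.length + 1 + l.length
  lenPtr : σ 33 0 = H.length

theorem Writing.congr {σ τ : State} {H l : List ℕ} (h : Writing σ H l) (h1 : τ 1 = σ 1)
    (h2 : τ 32 = σ 32) (h3 : τ 33 = σ 33) : Writing τ H l :=
  ⟨by rw [h1]; exact h.seg, by rw [h2]; exact h.ptr, by rw [h3]; exact h.lenPtr⟩

/-- Append the vertex `reg 36` to the tour. -/
def emitProg : Prog :=
  seq (set 1 (reg 32) (reg 36)) <| seq (setReg 32 (reg 32 + const 1)) <|
    set 1 (reg 33) (get 1 (reg 33) + const 1)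

theorem Writing.emit {σ : State} {H l : List ℕ} (h : Writing σ H l) {w : ℕ} (hw : σ 36 0 = w) :
    Writing (emitProg.eval σ) H (l ++ [w]) := by
  obtain ⟨h1, h2, h3⟩ := h
  rw [seg_append, seg_cons, zero_add] at h1
  obtain ⟨a1, a2, a3⟩ := h1
  have hf : ∀ i, emitProg.eval σ 1 i = if i = H.length then l.length + 1 else
      if i = H.length + 1 + l.length then w else σ 1 i := by
    intro i
    have : H.length ≠ H.length + 1 + l.length := by omega
    simp [emitProg, State.write_apply, h2, h3, hw, a2, this]
  refine ⟨?_, ?_, ?_⟩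
  · rw [seg_append, seg_cons, seg_append, seg_cons, zero_add]
    refine ⟨a1.congr fun i _ hi => ?_, ?_, a3.congr fun i hi hi' => ?_, ?_, seg_nil _ _⟩
    · rw [hf, if_neg (by omega), if_neg (by omega)]
    · rw [hf, if_pos rfl]; simp
    · rw [hf, if_neg (by omega), if_neg (by omega)]
    · rw [hf, if_neg (by omega), if_pos rfl]
  · simp [emitProg, State.write_apply, h2]; omega
  · simp [emitProg, State.write_apply, h3]

/-- There is a walk from the depot to `u` with list of vertices `l` and scaled weight `len`. -/
def WalkTo (I : Instance) (l : List ℕ) (u len : ℕ) : Prop :=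
  ∃ (hu : u < I.n + 1) (p : I.G.Walk 0 ⟨u, hu⟩), p.support.map Fin.val = l ∧ wlen I.wt p = len

theorem WalkTo.le {I : Instance} {l : List ℕ} {u len : ℕ} (h : WalkTo I l u len) : u ≤ I.n := by
  obtain ⟨hu, -⟩ := h
  omega

theorem WalkTo.mem {I : Instance} {l : List ℕ} {u len : ℕ} (h : WalkTo I l u len) : u ∈ l := by
  obtain ⟨hu, p, rfl, -⟩ := h
  exact List.mem_map.2 ⟨_, p.end_mem_support, rfl⟩

theorem walkTo_zero (I : Instance) : WalkTo I [0] 0 0 := ⟨by omega, .nil, rfl, rfl⟩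

theorem WalkTo.concat {I : Instance} {l : List ℕ} {u len w : ℕ} (h : WalkTo I l u len)
    (hw : I.AdjN u w) : WalkTo I (l ++ [w]) w (len + I.W u w) := by
  obtain ⟨hu, p, rfl, rfl⟩ := h
  obtain ⟨_, hw, hadj⟩ := hw
  refine ⟨hw, p.concat hadj, ?_, ?_⟩
  · simp [SimpleGraph.Walk.support_concat]
  · rw [wlen_concat]; rfl

/-- Extend the tour from the vertex `reg 34` to the vertex `reg 35`. -/
def pathProg : Prog :=
  .loop 7 <| seq (setReg 36 (get 11 (addrE (reg 0 + const 1 - reg 7) (reg 34) (reg 35)))) <|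
    ite (Expr.eq (reg 36) (reg 34)) skip (seq emitProg (setReg 34 (reg 36)))

theorem pathProg_spec {I : Instance} {σ : State} (h : Ready I σ) {u v len : ℕ} {H l : List ℕ}
    (hu : σ 34 0 = u) (hv : σ 35 0 = v) (hvn : v ≤ I.n) (hW : Writing σ H l)
    (hl : WalkTo I l u len) :
    ∃ l', l ⊆ l' ∧ WalkTo I l' v (len + I.dist u v) ∧ Writing (pathProg.eval σ) H l' ∧
      pathProg.eval σ 34 0 = v := by
  have hun := hl.le
  have key := loop_induction (v := 7) (σ := σ) (P := seq (setReg 36 (get 11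
    (addrE (reg 0 + const 1 - reg 7) (reg 34) (reg 35)))) <|
    ite (Expr.eq (reg 36) (reg 34)) skip (seq emitProg (setReg 34 (reg 36))))
    (fun k τ => (∀ a ∈ [0, 10, 11, 35], τ a = σ a) ∧ ∃ l' u' len', l ⊆ l' ∧ WalkTo I l' u' len' ∧
      Writing τ H l' ∧ τ 34 0 = u' ∧ σ 10 (addr I.n (I.n + 1 - k) u' v) ≠ 0 ∧
      len' + σ 10 (addr I.n (I.n + 1 - k) u' v) = len + I.dist u v + 1) ?_ ?_
  · obtain ⟨-, l', u', len', b1, b2, b3, b4, b5, b6⟩ := key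
    rw [h.input.zero] at b5 b6
    simp only [Nat.sub_self] at b5 b6
    rw [h.tables.zero _ b2.le _ hvn] at b5 b6
    have huv : u' = v := by by_contra hcon; simp [hcon] at b5
    subst huv
    rw [if_pos rfl] at b6
    obtain rfl : len' = len + I.dist u u' := by omega
    exact ⟨l', b1, b2, b3, b4⟩
  · refine ⟨by simp [State.write_of_ne], l, u, len, List.Subset.refl _, hl,
      hW.congr (by simp [State.write_of_ne]) (by simp [State.write_of_ne])
      (by simp [State.write_of_ne]), by simp [State.write_apply, hu], ?_, ?_⟩
    · rw [Nat.sub_zero, h.tables.eq_dist hun hvn]; omega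
    · rw [Nat.sub_zero, h.tables.eq_dist hun hvn]; omega
  · rintro k hk τ hτk ⟨a1, l', u', len', b1, b2, b3, b4, b5, b6⟩
    rw [h.input.zero] at hk
    have hin : HasInput I τ := h.input.congr (a1 0 (by decide))
    have ek : I.n + 1 - k = I.n - k + 1 := by omega
    rw [ek] at b5 b6
    obtain ⟨w, hw, c1, c2, c3, c4⟩ := (h.tables.relaxed (I.n - k) (by omega) u' b2.le v hvn).step b5
    simp only [eval_seq, eval_setReg, eval_get, hin.eval_addrE, eval_sub, eval_add, eval_reg,
      eval_const, hin.zero, hτk, b4, a1 35 (by decide), hv, a1 11 (by decide), ek, c1]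
    set τ₁ := τ.write 36 0 w with hτ₁
    have e36 : τ₁ 36 0 = w := by simp [hτ₁, State.write_apply]
    have e34 : τ₁ 34 0 = u' := by simp [hτ₁, State.write_apply, b4]
    have hW₁ : Writing τ₁ H l' := b3.congr (by simp [hτ₁, State.write_of_ne])
      (by simp [hτ₁, State.write_of_ne]) (by simp [hτ₁, State.write_of_ne])
    have hfr₁ : ∀ a ∈ [0, 10, 11, 35], τ₁ a = σ a := by
      intro a ha
      rw [← a1 a ha, hτ₁, State.write_of_ne _ _ _ (by simp at ha; omega)]
    have ek' : I.n + 1 - (k + 1) = I.n - k := by omega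
    rw [eval_ite, eval_eq, eval_reg, eval_reg, e36, e34, ek']
    by_cases hwu : w = u'
    · subst hwu
      rw [if_pos (by simp), eval_skip]
      rw [I.W_self hw, zero_add] at c4
      refine ⟨fun a ha => ?_, l', w, len', b1, b2, hW₁.congr (by simp [State.write_of_ne])
        (by simp [State.write_of_ne]) (by simp [State.write_of_ne]),
        by simp [State.write_apply, e34], c3, by omega⟩
      rw [State.write_of_ne _ _ _ (by simp at ha; omega), hfr₁ a ha]
    · rw [if_neg (by simp [hwu])]
      have hadj := c2.resolve_left hwu
      refine ⟨fun a ha => ?_, l' ++ [w], w, len' + I.W u' w,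
        fun x hx => List.mem_append_left _ (b1 hx), b2.concat hadj,
        (hW₁.emit e36).congr (by simp [State.write_of_ne]) (by simp [State.write_of_ne])
          (by simp [State.write_of_ne]),
        ?_, c3, by omega⟩
      · rw [State.write_of_ne _ _ _ (by simp at ha; omega), ← hfr₁ a ha]
        refine eval_of_not_mem_writes _ _ ?_
        simp [emitProg, writes, writes_setReg] at ha ⊢
        omega
      · simp [State.write_apply, emitProg, e36]

/-- Visit the marked vertices of the group `reg 12` in the order of their positions, and return to
the depot. -/
def visitProg : Prog :=
  .loop 13 <| seq (argmin (get 20 (reg 2) * Expr.eq (get 21 (reg 2) / reg 31) (reg 12))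
    (get 21 (reg 2))) <|
    seq (setReg 35 (reg 3)) <| seq (set 20 (reg 35) (const 0)) pathProg

theorem pathProg_frame (σ : State) {a : ℕ} (ha : a ∉ [1, 7, 32, 34, 36]) :
    pathProg.eval σ a = σ a :=
  eval_of_not_mem_writes _ _ (by
    simp [pathProg, emitProg, writes, writes_setReg] at ha ⊢
    omega)

-- Twice the distance from the depot to the first vertex, and from the last one back, is at most β;
-- in between, each leg costs at most the difference of positions, and these differences sum to at
-- most `q - 1` within one group.
open Classical in
theorem visitProg_spec {I : Instance} {σ : State} (h : Ready I σ) {H : List ℕ} {g q : ℕ}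
    (hq : 0 < q) (hσq : σ 31 0 = q) (hσg : σ 12 0 = g) (h34 : σ 34 0 = 0) (hW : Writing σ H [0])
    (h20 : σ 20 0 = 0)
    (hd : ∀ v ≤ I.n, σ 20 v ≠ 0 → ∀ w ≤ I.n, σ 20 w ≠ 0 → σ 21 v ≤ σ 21 w →
      I.dist v w + σ 21 v ≤ σ 21 w) :
    ∃ l len, WalkTo I l 0 len ∧ Writing (visitProg.eval σ) H l ∧
      (∀ v ≤ I.n, σ 20 v ≠ 0 → σ 21 v / q = g → v ∈ l) ∧
      (∀ β, I.DailyBound β → len ≤ β + (q - 1)) ∧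
      ∀ v ≤ I.n, visitProg.eval σ 20 v = if σ 21 v / q = g then 0 else σ 20 v := by
  set R₀ : Finset ℕ := (Finset.range (I.n + 1)).filter fun v => σ 20 v ≠ 0 ∧ σ 21 v / q = g with hR₀
  have hmem : ∀ v, v ∈ R₀ ↔ v ≤ I.n ∧ σ 20 v ≠ 0 ∧ σ 21 v / q = g := by
    intro v; simp [hR₀]
  have hpos : ∀ v ∈ R₀, g * q ≤ σ 21 v ∧ σ 21 v < g * q + q := by
    intro v hv
    obtain ⟨-, -, rfl⟩ := (hmem v).1 hv
    have := Nat.lt_div_mul_add (a := σ 21 v) hq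
    exact ⟨Nat.div_mul_le_self _ _, by omega⟩
  -- The depot is unmarked, so n + 1 rounds leave at least one for the return.
  have hcard : R₀.card ≤ I.n := by
    have : R₀ ⊆ (Finset.range (I.n + 1)).erase 0 := by
      intro v hv
      have := (hmem v).1 hv
      rw [Finset.mem_erase, Finset.mem_range]
      exact ⟨fun h0 => this.2.1 (h0 ▸ h20), by omega⟩
    have := Finset.card_le_card this
    rwa [Finset.card_erase_of_mem (by simp), Finset.card_range] at this
  have key := loop_induction (v := 13) (σ := σ) (P := seq (argmin (get 20 (reg 2) *
    Expr.eq (get 21 (reg 2) / reg 31) (reg 12)) (get 21 (reg 2))) <|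
    seq (setReg 35 (reg 3)) <| seq (set 20 (reg 35) (const 0)) pathProg)
    (fun r τ => (∀ a ∈ [0, 10, 11, 12, 21, 31], τ a = σ a) ∧
      ∃ (R : Finset ℕ) (l : List ℕ) (u len : ℕ), R ⊆ R₀ ∧
      (∀ v ≤ I.n, τ 20 v = if v ∈ R₀ ∧ v ∉ R then 0 else σ 20 v) ∧
      (∀ v ∈ R₀, v ∉ R → v ∈ l) ∧ τ 34 0 = u ∧ WalkTo I l u len ∧ Writing τ H l ∧
      -- Three phases: not yet departed, at the last visited vertex `u` of the group, returned to
      -- the depot. Doubling in the second phase avoids halving β.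
      ((r + R.card ≤ I.n ∧ u = 0 ∧ len = 0) ∨
       (r + R.card ≤ I.n ∧ u ∈ R₀ ∧ (∀ v ∈ R, σ 21 u ≤ σ 21 v) ∧
        ∀ β, I.DailyBound β → 2 * len + 2 * (g * q) ≤ β + 2 * σ 21 u) ∨
       (R = ∅ ∧ u = 0 ∧ ∀ β, I.DailyBound β → len ≤ β + (q - 1)))) ?_ ?_
  · obtain ⟨-, R, l, u, len, b1, b2, b3, b4, b5, b6, b7⟩ := key
    rw [h.input.zero] at b7
    obtain ⟨rfl, rfl, b8⟩ : R = ∅ ∧ u = 0 ∧ ∀ β, I.DailyBound β → len ≤ β + (q - 1) := by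
      rcases b7 with ⟨b7, -⟩ | ⟨b7, -⟩ | b7
      · omega
      · omega
      · exact b7
    refine ⟨l, len, b5, b6, fun v hv h1 h2 => b3 v ((hmem v).2 ⟨hv, h1, h2⟩) (by simp), b8, ?_⟩
    intro v hv
    refine (b2 v hv).trans ?_
    simp only [hmem, hv, Finset.notMem_empty, true_and, not_false_eq_true, and_true]
    by_cases h0 : σ 20 v = 0 <;> simp [h0]
  · exact ⟨by simp [State.write_of_ne], R₀, [0], 0, 0, Finset.Subset.refl _,
      fun v hv => by rw [State.write_of_ne _ _ _ (by decide), if_neg (by tauto)],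
      fun v h1 h2 => absurd h1 h2, by simp [State.write_apply, h34], walkTo_zero I,
      hW.congr (by simp [State.write_of_ne]) (by simp [State.write_of_ne])
      (by simp [State.write_of_ne]), Or.inl ⟨by omega, rfl, rfl⟩⟩
  · rintro r - τ - ⟨a1, R, l, u, len, b1, b2, b3, b4, b5, b6, b7⟩
    have hR : Ready I τ := h.congr (a1 _ (by decide)) (a1 _ (by decide)) (a1 _ (by decide))
    simp only [eval_seq]
    generalize hρ : (argmin _ _).eval τ = ρ
    have hfr : ∀ a ∉ [2, 3, 4, 5], ρ a = τ a :=
      fun a ha => by rw [← hρ]; exact argmin_frame _ _ _ ha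
    have hmin := argmin_spec (fun x => τ 20 x * if σ 21 x / q = g then 1 else 0)
      (fun x => σ 21 x) (fun ρ' hρ' => by
        simp only [eval_mul, eval_get, eval_reg, eval_eq, eval_div, hρ' 20 (by decide),
          hρ' 21 (by decide), hρ' 31 (by decide), hρ' 12 (by decide), a1 21 (by decide),
          a1 31 (by decide), a1 12 (by decide), hσq, hσg]
        constructor <;> first | rfl | trivial) hρ
    rw [hR.input.zero] at hmin
    have hguard : ∀ x ≤ I.n, (τ 20 x * if σ 21 x / q = g then 1 else 0) ≠ 0 ↔ x ∈ R := by
      intro x hx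
      rw [b2 x hx]
      by_cases hxR : x ∈ R
      · have := (hmem x).1 (b1 hxR)
        simp [hxR, this.2.1, this.2.2]
      · have := hmem x
        simp only [hxR, iff_false, not_not, not_false_eq_true, and_true]
        by_cases hx0 : x ∈ R₀
        · simp [hx0]
        · rw [this] at hx0
          rw [if_neg (by rwa [this])]
          by_cases hg : σ 21 x / q = g
          · have : σ 20 x = 0 := by by_contra hcon; exact hx0 ⟨hx, hcon, hg⟩
            simp [this]
          · simp [hg]
    simp only [eval_setReg, eval_reg, eval_set, eval_const]
    set x := ρ 3 0 with hx
    set ρ₁ := (ρ.write 35 0 x).write 20 ((ρ.write 35 0 x) 35 0) 0 with hρ₁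
    have e35 : ρ₁ 35 0 = x := by simp [hρ₁, State.write_apply]
    have e34 : ρ₁ 34 0 = u := by simp [hρ₁, State.write_apply, hfr, b4]
    have e20 : ∀ v, ρ₁ 20 v = if v = x then 0 else τ 20 v := by
      intro v; simp [hρ₁, State.write_apply, hfr]
    have efr : ∀ a ∈ [0, 10, 11, 12, 21, 31], ρ₁ a = σ a := by
      intro a ha
      rw [← a1 a ha]
      simp at ha
      rw [hρ₁, State.write_of_ne _ _ _ (by omega), State.write_of_ne _ _ _ (by omega),
        hfr a (by simp; omega)]
    have hR₁ : Ready I ρ₁ := h.congr (efr _ (by decide)) (efr _ (by decide)) (efr _ (by decide))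
    have hW₁ : Writing ρ₁ H l := b6.congr (by simp [hρ₁, State.write_of_ne, hfr])
      (by simp [hρ₁, State.write_of_ne, hfr]) (by simp [hρ₁, State.write_of_ne, hfr])
    have hxn : x ≤ I.n := by rcases hmin with h' | h' <;> omega
    obtain ⟨l', p1, p2, p3, p4⟩ := pathProg_spec hR₁ e34 e35 hxn hW₁ b5
    refine ⟨fun a ha => ?_, R.erase x, l', x, len + I.dist u x,
      (Finset.erase_subset _ _).trans b1, fun v hv => ?_, fun v hv0 hvR => ?_, ?_, p2,
      p3.congr (by simp [State.write_of_ne]) (by simp [State.write_of_ne])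
        (by simp [State.write_of_ne]), ?_⟩
    · rw [State.write_of_ne _ _ _ (by simp at ha; omega), pathProg_frame _ (by simp at ha ⊢; omega),
        efr a ha]
    · rw [State.write_of_ne _ _ _ (by decide), pathProg_frame _ (by decide), e20, b2 v hv]
      by_cases hvx : v = x
      · simp only [hvx, if_true, Finset.mem_erase, ne_eq, not_true_eq_false, false_and,
          not_false_eq_true, and_true]
        split_ifs with hx0
        · rfl
        -- An unsuccessful search returns the depot, which was unmarked from the beginning.
        · rcases hmin with ⟨-, h2, -⟩ | ⟨-, h2, h3, -⟩
          · rw [h2, h20]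
          · exact absurd (b1 ((hguard x h2).1 h3)) hx0
      · simp [hvx]
    · by_cases hvx : v = x
      · rw [hvx]; exact p2.mem
      · exact p1 (b3 v hv0 fun hv => hvR (Finset.mem_erase.2 ⟨hvx, hv⟩))
    · rw [State.write_of_ne _ _ _ (by decide), p4]
    · rcases hmin with ⟨-, h2, -, h4⟩ | ⟨-, h2, h3, h6, h5⟩
      · have hRe : R = ∅ := by
          rw [Finset.eq_empty_iff_forall_notMem]
          intro v hv
          have hvn := ((hmem v).1 (b1 hv)).1
          exact (hguard v hvn).2 hv (h4 v hvn)
        right; right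
        refine ⟨by simp [hRe], h2, fun β hβ => ?_⟩
        rw [h2]
        rcases b7 with ⟨-, rfl, rfl⟩ | ⟨-, hu, -, hlen⟩ | ⟨-, rfl, hlen⟩
        · rw [I.dist_self]; omega
        · have := hlen β hβ
          have := hβ.dist_le u
          have := hpos u hu
          rw [I.dist_comm]
          omega
        · rw [I.dist_self]; exact hlen β hβ
      · have hxR := (hguard x h2).1 h3
        have hxR₀ := b1 hxR
        have hcx := Finset.card_erase_add_one hxR
        right; left
        have hlast : ∀ v ∈ R.erase x, σ 21 x ≤ σ 21 v := by
          intro v hv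
          have hvR := Finset.mem_of_mem_erase hv
          have hvn := ((hmem v).1 (b1 hvR)).1
          have := h5 v hvn ((hguard v hvn).2 hvR)
          omega
        rcases b7 with ⟨hr, rfl, rfl⟩ | ⟨hr, hu, hle, hlen⟩ | ⟨rfl, -⟩
        · refine ⟨by omega, hxR₀, hlast, fun β hβ => ?_⟩
          have := hβ.dist_le x
          have := hpos x hxR₀
          omega
        · refine ⟨by omega, hxR₀, hlast, fun β hβ => ?_⟩
          have e1 := hlen β hβ
          obtain ⟨hun, hu0, -⟩ := (hmem u).1 hu
          have e2 := hd u hun hu0 x h2 ((hmem x).1 hxR₀).2.1 (hle x hxR)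
          omega
        · simp at hxR

end RFTT

namespace RFTT

open RAM RAM.Prog RAM.Expr

/-! ### Writing the timetable -/

/-- The memory holds the timetable `L` as output, and register `32` points to its end. -/
structure Written {I : Instance} (σ : State) (L : List I.Entry) : Prop where
  seg : Seg (σ 1) 0 (Instance.encodeTimetable L)
  ptr : σ 32 0 = (Instance.encodeTimetable L).length

theorem Written.congr {I : Instance} {σ τ : State} {L : List I.Entry} (h : Written σ L)
    (h1 : τ 1 = σ 1) (h2 : τ 32 = σ 32) : Written τ L :=
  ⟨by rw [h1]; exact h.seg, by rw [h2]; exact h.ptr⟩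

/-- Start a new line with period `reg 30` and offset `reg 12`. -/
def beginProg : Prog :=
  seq (set 1 (const 0) (get 1 (const 0) + const 1)) <|
  seq (set 1 (reg 32) (reg 30)) <| seq (set 1 (reg 32 + const 1) (reg 12)) <|
  seq (setReg 33 (reg 32 + const 2)) <| seq (set 1 (reg 32 + const 2) (const 1)) <|
  seq (set 1 (reg 32 + const 3) (const 0)) <| seq (setReg 32 (reg 32 + const 4)) <|
  setReg 34 (const 0)

/-- The output in front of the tour of a new line. -/
def header {I : Instance} (L : List I.Entry) (K g : ℕ) : List ℕ :=
  (L.length + 1) :: (L.flatMap Instance.Entry.encode ++ [K, g])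

theorem beginProg_spec {I : Instance} {σ : State} {L : List I.Entry} (h : Written σ L) {K g : ℕ}
    (hK : σ 30 0 = K) (hg : σ 12 0 = g) : Writing (beginProg.eval σ) (header L K g) [0] := by
  obtain ⟨h1, h2⟩ := h
  set F := L.flatMap Instance.Entry.encode with hF
  have hp : σ 32 0 = F.length + 1 := by rw [h2]; simp [Instance.encodeTimetable, hF]
  rw [Instance.encodeTimetable, seg_cons] at h1
  obtain ⟨a1, a2⟩ := h1
  have hf : ∀ i, beginProg.eval σ 1 i = if i = F.length + 1 + 3 then 0 else
      if i = F.length + 1 + 2 then 1 else if i = F.length + 1 + 1 then g else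
      if i = F.length + 1 then K else if i = 0 then L.length + 1 else σ 1 i := by
    intro i
    simp [beginProg, State.write_apply, hp, hK, hg, a1]
  have hlen : (header L K g).length = F.length + 3 := by simp [header, hF]
  refine ⟨?_, ?_, ?_⟩
  · rw [seg_append, hlen, header, ← hF]
    simp only [seg_cons, seg_append, zero_add, List.length_singleton]
    refine ⟨⟨?_, a2.congr fun i hi hi' => ?_, ?_, ?_, seg_nil _ _⟩, ?_, ?_, seg_nil _ _⟩
    · rw [hf]; simp
    · replace hi' : i < 0 + 1 + F.length := hi'
      rw [hf, if_neg (by omega), if_neg (by omega), if_neg (by omega), if_neg (by omega),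
        if_neg (by omega)]
    · rw [hf, if_neg (by omega), if_neg (by omega), if_neg (by omega), if_pos (by omega)]
    · rw [hf, if_neg (by omega), if_neg (by omega), if_pos (by omega)]
    · rw [hf, if_neg (by omega), if_pos (by omega)]
    · rw [hf, if_pos (by omega)]
  · rw [hlen]; simp [beginProg, State.write_apply, hp]
  · rw [hlen]; simp [beginProg, State.write_apply, hp]

/-- The header already counts the new line, so a finished tour completes a valid timetable without
further writing. -/
theorem Writing.written {I : Instance} {σ : State} {L : List I.Entry} {e : I.Entry} {l : List ℕ}
    (h : Writing σ (header L e.period e.offset) l) (hl : e.tour.support.map Fin.val = l) :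
    Written σ (L ++ [e]) := by
  have heq : header L e.period e.offset ++ l.length :: l = Instance.encodeTimetable (L ++ [e]) := by
    subst hl
    simp [header, Instance.encodeTimetable, Instance.Entry.encode]
  refine ⟨heq ▸ h.seg, ?_⟩
  rw [h.ptr, ← heq, List.length_append, List.length_cons]
  omega

/-- The timetable `L` visits the client `v` often enough. -/
def Serves {I : Instance} (L : List I.Entry) (v : ℕ) : Prop :=
  ∃ e ∈ L, e.period ≤ I.tau v ∧ v ∈ e.tour.support.map Fin.val

theorem Serves.append {I : Instance} {L : List I.Entry} {v : ℕ} (h : Serves L v)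
    (M : List I.Entry) : Serves (L ++ M) v := by
  obtain ⟨e, he, h⟩ := h
  exact ⟨e, List.mem_append_left _ he, h⟩

/-- The scaled length of the tours of day `k`. -/
noncomputable def dayLength {I : Instance} (L : List I.Entry) (k : ℕ) : ℕ := wlen I.wt (Instance.solutionOf L k)

/-- Write the lines of the class with `2 ^ c = reg 30`. -/
def classProg : Prog :=
  seq primProg <| seq (set 20 (const 0) (const 0)) <| seq (setReg 31 (reg 22 / reg 30 + const 1)) <|
  .loop 12 <| ite (reg 30 - reg 12) (seq beginProg visitProg) skip

theorem writes_visit : ∀ a ∈ (seq beginProg visitProg).writes,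
    a ∈ [1, 2, 3, 4, 5, 7, 13, 20, 32, 33, 34, 35, 36] := by
  simp [beginProg, visitProg, pathProg, emitProg, writes, writes_argmin, writes_setReg]

theorem writes_prim : ∀ a ∈ primProg.writes,
    a ∈ [2, 3, 4, 5, 7, 12, 20, 21, 22, 23, 24, 25, 26, 27, 28] := by
  simp [primProg, primStepProg, nearProg, attachProg, shiftProg, writes, writes_argmin,
    writes_setReg]

/-- The groups are visited on distinct residues modulo 2^c, so each day receives just one tour of
the class. The assumption 2^c ≤ n makes the n + 1 iterations sufficient for all groups. -/
theorem classProg_spec {I : Instance} {c : ℕ} {σ : State} (h : Ready I σ) (hc : σ 30 0 = 2 ^ c)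
    (hcn : 2 ^ c ≤ I.n) {L₀ : List I.Entry} (hL₀ : Written σ L₀) :
    ∃ M : List I.Entry, Written (classProg.eval σ) (L₀ ++ M) ∧
      (∀ v ∈ I.classOf c, Serves (L₀ ++ M) v) ∧
      ∀ β, I.DailyBound β → ∀ k, dayLength (L₀ ++ M) k ≤ dayLength L₀ k + 5 * β := by
  simp only [classProg, eval_seq]
  obtain ⟨A, t, hCA, hT⟩ := primProg_spec h hc
  have hfr : ∀ a ∉ [2, 3, 4, 5, 7, 12, 20, 21, 22, 23, 24, 25, 26, 27, 28],
      primProg.eval σ a = σ a := fun a ha =>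
    eval_of_not_mem_writes _ _ fun ha' => ha (writes_prim a ha')
  generalize primProg.eval σ = τ at *
  simp only [eval_set, eval_setReg, eval_div, eval_add, eval_const, eval_reg]
  have e22 : (τ.write 20 0 0) 22 0 = 2 * t := by
    rw [State.write_of_ne _ _ _ (by decide), hT.total]
  have e30 : (τ.write 20 0 0) 30 0 = 2 ^ c := by
    rw [State.write_of_ne _ _ _ (by decide), hfr 30 (by decide), hc]
  rw [e22, e30]
  set q := 2 * t / 2 ^ c + 1 with hq
  set τ₁ := (τ.write 20 0 0).write 31 0 q with hτ₁
  have hR₁ : Ready I τ₁ := h.congr (by simp [hτ₁, State.write_of_ne, hfr])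
    (by simp [hτ₁, State.write_of_ne, hfr]) (by simp [hτ₁, State.write_of_ne, hfr])
  have h30 : τ₁ 30 0 = 2 ^ c := by rw [← e30, hτ₁, State.write_of_ne _ _ _ (by decide)]
  have h31 : τ₁ 31 0 = q := by simp [hτ₁, State.write_apply]
  have h21 : τ₁ 21 = τ 21 := by simp [hτ₁, State.write_of_ne]
  have hK : 0 < 2 ^ c := by positivity
  have hq0 : 0 < q := Nat.succ_pos _
  -- The summand 1 in `q` makes 2^c groups cover the line including its right end 2t.
  have hgroup : ∀ v ∈ A, τ 21 v / q < 2 ^ c := by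
    intro v hv
    have h1 := hT.pos_le v hv
    rw [Nat.div_lt_iff_lt_mul hq0]
    exact h1.trans_lt (Nat.lt_mul_div_succ (2 * t) hK)
  -- From t ≤ 2^(c+1) β follows 2t / 2^c ≤ 4β; the fifth β is for leaving and reaching the depot.
  have hlen : ∀ β, I.DailyBound β → β + (q - 1) ≤ 5 * β := by
    intro β hβ
    have h1 := hβ.prim_le hT.run
    have h2 : 2 * t / 2 ^ c ≤ 4 * β := by
      rw [Nat.div_le_iff_le_mul_add_pred hK]
      rw [pow_succ] at h1
      have : 2 ^ c * (4 * β) = 2 * (2 ^ c * 2 * β) := by ring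
      omega
    omega
  have key := loop_induction (v := 12) (σ := τ₁)
    (P := ite (reg 30 - reg 12) (seq beginProg visitProg) skip)
    (fun g ρ => (∀ a ∈ [0, 10, 11, 21, 30, 31], ρ a = τ₁ a) ∧
      (∀ v ≤ I.n, ρ 20 v = if v ∈ A ∧ v ≠ 0 ∧ g ≤ τ 21 v / q then 1 else 0) ∧
      ∃ M : List I.Entry, Written ρ (L₀ ++ M) ∧
      (∀ v ∈ I.classOf c, τ 21 v / q < g → Serves (L₀ ++ M) v) ∧
      ∀ β, I.DailyBound β → ∀ k, dayLength (L₀ ++ M) k ≤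
        dayLength L₀ k + if k % 2 ^ c < g then 5 * β else 0) ?_ ?_
  · obtain ⟨-, -, M, h1, h2, h3⟩ := key
    rw [hR₁.input.zero] at h2
    refine ⟨M, h1, fun v hv => h2 v hv ?_, fun β hβ k => (h3 β hβ k).trans ?_⟩
    · have := hgroup v (hCA hv)
      omega
    · split_ifs <;> omega
  · refine ⟨fun a ha => State.write_of_ne _ _ _ (by simp at ha; omega), fun v hv => ?_, [], ?_, ?_, ?_⟩
    · simp only [hτ₁, State.write_apply]
      norm_num
      by_cases hv0 : v = 0
      · simp [hv0]
      · simp [hv0, hT.marks v hv]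
    · rw [List.append_nil]
      exact hL₀.congr (by simp [hτ₁, State.write_of_ne, hfr]) (by simp [hτ₁, State.write_of_ne, hfr])
    · simp
    · simp
  · rintro g hg ρ hρg ⟨a1, a2, M, a3, a4, a5⟩
    rw [eval_ite, eval_sub, eval_reg, eval_reg, a1 30 (by decide), h30, hρg]
    by_cases hgK : g < 2 ^ c
    swap
    · rw [if_neg (by omega), eval_skip]
      refine ⟨fun a ha => ?_, fun v hv => ?_, M, a3.congr (by simp [State.write_of_ne])
        (by simp [State.write_of_ne]), fun v hv _ => a4 v hv ?_, fun β hβ k => ?_⟩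
      · rw [State.write_of_ne _ _ _ (by simp at ha; omega), a1 a ha]
      · rw [State.write_of_ne _ _ _ (by decide), a2 v hv]
        by_cases hvA : v ∈ A
        · have := hgroup v hvA
          rw [if_neg (by omega), if_neg (by omega)]
        · simp [hvA]
      · have := hgroup v (hCA hv)
        omega
      · have := Nat.mod_lt k hK
        rw [if_pos (by omega)]
        have := a5 β hβ k
        rwa [if_pos (by omega)] at this
    rw [if_pos (by omega), eval_seq]
    have hfv : ∀ a ∉ [1, 2, 3, 4, 5, 7, 13, 20, 32, 33, 34, 35, 36],
        visitProg.eval (beginProg.eval ρ) a = ρ a := fun a ha =>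
      eval_of_not_mem_writes (seq beginProg visitProg) _ fun ha' => ha (writes_visit a ha')
    have hfb : ∀ a ∉ [1, 32, 33, 34], beginProg.eval ρ a = ρ a := fun a ha =>
      eval_of_not_mem_writes _ _ (by
        simp [beginProg, writes, writes_setReg] at ha ⊢; omega)
    have hW := beginProg_spec a3 (K := 2 ^ c) (by rw [a1 30 (by decide), h30]) hρg
    have h34 : beginProg.eval ρ 34 0 = 0 := by simp [beginProg, State.write_apply]
    generalize beginProg.eval ρ = ρ₁ at *
    have e21 : ρ₁ 21 = τ 21 := by rw [hfb 21 (by decide), a1 21 (by decide), h21]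
    have e20 : ρ₁ 20 = ρ 20 := hfb 20 (by decide)
    have hmark : ∀ v ≤ I.n, ρ₁ 20 v ≠ 0 → v ∈ A := by
      intro v hv hne
      rw [e20, a2 v hv] at hne
      by_contra hcon
      simp [hcon] at hne
    obtain ⟨l, len, p1, p2, p3, p4, p5⟩ := visitProg_spec (I := I) (σ := ρ₁) (g := g) (q := q)
      (hR₁.congr (by rw [hfb 0 (by decide), a1 0 (by decide)])
        (by rw [hfb 10 (by decide), a1 10 (by decide)])
        (by rw [hfb 11 (by decide), a1 11 (by decide)])) hq0
      (by rw [hfb 31 (by decide), a1 31 (by decide), h31]) (by rw [hfb 12 (by decide), hρg])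
      h34 hW (by rw [e20, a2 0 (by omega)]; simp)
      (fun v hv hv0 w hw hw0 => by
        rw [e21]; exact hT.dist_le v (hmark v hv hv0) w (hmark w hw hw0))
    obtain ⟨_, p, hp, rfl⟩ := p1
    set e : I.Entry := ⟨2 ^ c, hK, g, p⟩ with he
    have hday : ∀ k, dayLength (L₀ ++ (M ++ [e])) k = dayLength (L₀ ++ M) k +
        if k % 2 ^ c = g then wlen I.wt p else 0 := by
      intro k
      rw [← List.append_assoc]
      simp only [dayLength]
      rw [Instance.solutionOf_append, Instance.wlen_solutionOf_singleton]
      congr 1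
      simp only [he, Nat.ModEq, Nat.mod_eq_of_lt hgK]
      split_ifs <;> rfl
    refine ⟨fun a ha => ?_, fun v hv => ?_, M ++ [e], ?_, fun v hv hvg => ?_, fun β hβ k => ?_⟩
    · rw [State.write_of_ne _ _ _ (by simp at ha; omega), hfv a (by simp at ha ⊢; omega), a1 a ha]
    · rw [State.write_of_ne _ _ _ (by decide), p5 v hv, e20, e21, a2 v hv]
      by_cases hvg : τ 21 v / q = g
      · rw [if_pos hvg, if_neg (by omega)]
      · have : g ≤ τ 21 v / q ↔ g + 1 ≤ τ 21 v / q := by omega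
        simp only [hvg, if_false, this]
    · rw [← List.append_assoc]
      exact (p2.written (e := e) hp).congr (by simp [State.write_of_ne]) (by simp [State.write_of_ne])
    · rw [← List.append_assoc]
      by_cases hvg' : τ 21 v / q = g
      · refine ⟨e, by simp, ?_, ?_⟩
        · exact hv.2.2.1.trans (min_le_left _ _)
        · change v ∈ p.support.map Fin.val
          rw [hp]
          refine p3 v hv.2.1 ?_ (by rw [e21]; exact hvg')
          have := hv.1
          rw [e20, a2 v hv.2.1, if_pos ⟨hCA hv, by omega, by omega⟩]
          exact one_ne_zero
      · exact (a4 v hv (by omega)).append _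
    · rw [hday]
      have h1 := a5 β hβ k
      have h2 := p4 β hβ
      have h3 := hlen β hβ
      split_ifs at h1 ⊢ <;> omega

/-! ### The complete algorithm and its ratio -/

/-- The approximation algorithm. -/
def mainProg : Prog :=
  seq scaleProg <| seq tablesProg <| seq (setReg 30 (const 1)) <| seq (setReg 32 (const 1)) <|
  seq (set 1 (const 0) (const 0)) <|
  .loop 6 <| seq (ite (reg 0 + const 1 - reg 30) classProg skip) (setReg 30 (reg 30 + reg 30))

theorem mainProg_WF : mainProg.WF := by decide

theorem writes_class : ∀ a ∈ classProg.writes, a ∉ [0, 6, 10, 11, 30] := by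
  simp [classProg, primProg, primStepProg, nearProg, attachProg, shiftProg, beginProg, visitProg,
    pathProg, emitProg, writes, writes_argmin, writes_setReg]

/-- Rounds with 2^c > n do nothing, since such classes are empty; at most log₂ n + 1 rounds
contribute 5β each to a day. -/
theorem mainProg_spec (I : Instance) {σ : State} (h : HasInput I σ) :
    ∃ L : List I.Entry, Written (mainProg.eval σ) L ∧ (∀ v, 1 ≤ v → v ≤ I.n → Serves L v) ∧
      ∀ β, I.DailyBound β → ∀ k, dayLength L k ≤ 5 * (Nat.log 2 I.n + 1) * β := by
  simp only [mainProg, eval_seq]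
  have h9 := scaleProg_spec h
  have hin₁ : HasInput I (scaleProg.eval σ) := h.congr (eval_input (by decide) _)
  generalize scaleProg.eval σ = σ₁ at *
  have htab := tablesProg_spec hin₁ h9
  have hin₂ : HasInput I (tablesProg.eval σ₁) := hin₁.congr (eval_input (by decide) _)
  generalize tablesProg.eval σ₁ = σ₂ at *
  simp only [eval_set, eval_setReg, eval_const]
  set σ₃ := ((σ₂.write 30 0 1).write 32 0 1).write 1 0 0 with hσ₃
  have hR : Ready I σ₃ := Ready.congr ⟨hin₂, htab⟩ (by simp [hσ₃, State.write_of_ne])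
    (by simp [hσ₃, State.write_of_ne]) (by simp [hσ₃, State.write_of_ne])
  have key := loop_induction (v := 6) (σ := σ₃)
    (P := seq (ite (reg 0 + const 1 - reg 30) classProg skip) (setReg 30 (reg 30 + reg 30)))
    (fun c ρ => (∀ a ∈ [0, 10, 11], ρ a = σ₃ a) ∧ ρ 30 0 = 2 ^ c ∧ ∃ L : List I.Entry,
      Written ρ L ∧ (∀ c' < c, ∀ v ∈ I.classOf c', Serves L v) ∧
      ∀ β, I.DailyBound β → ∀ k, dayLength L k ≤ 5 * min c (Nat.log 2 I.n + 1) * β) ?_ ?_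
  · obtain ⟨-, -, L, h1, h2, h3⟩ := key
    rw [hR.input.zero] at h2
    refine ⟨L, h1, fun v hv hvn => ?_, fun β hβ k => (h3 β hβ k).trans ?_⟩
    · have hτ : 0 < I.tau v := by
        have := I.tau_succ ⟨v - 1, by omega⟩
        simp only [Nat.sub_add_cancel hv] at this
        rw [this]
        exact I.τ_pos _
      have hm : min (I.tau v) I.n ≠ 0 := by omega
      -- The class of `v`; its index is smaller than the cut-off turnover time, hence reached by the
      -- loop.
      refine h2 (Nat.log 2 (min (I.tau v) I.n)) ?_ v
        ⟨hv, hvn, Nat.pow_log_le_self 2 hm, Nat.lt_pow_succ_log_self (by norm_num) _⟩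
      have := Nat.log_lt_self 2 hm
      omega
    · gcongr
      exact min_le_right _ _
  · refine ⟨fun a ha => State.write_of_ne _ _ _ (by simp at ha; omega),
      by simp [hσ₃, State.write_apply], [], ?_, by simp, ?_⟩
    · refine ⟨?_, ?_⟩
      · simp only [Instance.encodeTimetable, List.length_nil, List.flatMap_nil, seg_cons]
        exact ⟨by simp [hσ₃, State.write_apply], seg_nil _ _⟩
      · simp [hσ₃, State.write_apply, Instance.encodeTimetable]
    · simp [dayLength, Instance.solutionOf, wlen]
  · rintro c - ρ - ⟨a1, a2, L, a3, a4, a5⟩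
    have hρ : Ready I ρ := hR.congr (a1 _ (by decide)) (a1 _ (by decide)) (a1 _ (by decide))
    rw [eval_seq, eval_ite, eval_sub, eval_add, eval_reg, eval_reg, eval_const, a2,
      hρ.input.zero]
    by_cases hcn : 2 ^ c ≤ I.n
    · rw [if_pos (by omega)]
      obtain ⟨M, b1, b2, b3⟩ := classProg_spec hρ a2 hcn a3
      have hfr : ∀ a ∈ [0, 6, 10, 11, 30], classProg.eval ρ a = ρ a := fun a ha =>
        eval_of_not_mem_writes _ _ fun ha' => writes_class a ha' ha
      refine ⟨fun a ha => ?_, ?_, L ++ M, b1.congr (by simp [State.write_of_ne])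
        (by simp [State.write_of_ne]), fun c' hc' v hv => ?_, fun β hβ k => ?_⟩
      · rw [State.write_of_ne _ _ _ (by simp at ha; omega), eval_setReg,
          State.write_of_ne _ _ _ (by simp at ha; omega), hfr a (by simp at ha ⊢; omega), a1 a ha]
      · simp [State.write_apply, hfr, a2, pow_succ]; ring
      · rcases Nat.lt_or_eq_of_le (Nat.lt_succ_iff.1 hc') with hlt | rfl
        · exact (a4 c' hlt v hv).append M
        · exact b2 v hv
      · have hlog : c ≤ Nat.log 2 I.n := Nat.le_log_of_pow_le (by norm_num) hcn
        have h1 := a5 β hβ k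
        have h2 := b3 β hβ k
        rw [min_eq_left (by omega)] at h1 ⊢
        have : 5 * (c + 1) * β = 5 * c * β + 5 * β := by ring
        omega
    · rw [if_neg (by omega), eval_skip]
      refine ⟨fun a ha => ?_, ?_, L, a3.congr (by simp [State.write_of_ne])
        (by simp [State.write_of_ne]), fun c' hc' v hv => ?_, fun β hβ k => (a5 β hβ k).trans ?_⟩
      · rw [State.write_of_ne _ _ _ (by simp at ha; omega), eval_setReg,
          State.write_of_ne _ _ _ (by simp at ha; omega), a1 a ha]
      · simp [State.write_apply, a2, pow_succ]; ring
      · rcases Nat.lt_or_eq_of_le (Nat.lt_succ_iff.1 hc') with hlt | rfl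
        · exact a4 c' hlt v hv
        · exact absurd (hv.2.2.1.trans (min_le_right _ _)) hcn
      · gcongr
        omega

theorem exists_isMinMaxApprox : ∃ P : Cmd,
    IsMinMaxApprox P fun n => ((5 * (Nat.log 2 n + 1) : ℕ) : ℝ) := by
  obtain ⟨p, hp⟩ := exists_polynomial_time mainProg mainProg_WF
  refine ⟨mainProg.compile, p, fun I => ?_⟩
  obtain ⟨t, h1, h2⟩ := hp I.encode (by rw [I.encode_getD_zero]; exact I.length_encode)
  obtain ⟨L, b1, b2, b3⟩ := mainProg_spec I (σ := input I.encode) fun i => by simp [input]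
  refine ⟨_, t, L, h1, h2, fun i hi => ?_, Instance.feasible_of_covers b2,
    Instance.solutionOf_periodic L, Instance.maxTourLength_le (by omega) b3⟩
  have := b1.seg i hi
  rwa [zero_add, List.getD_eq_getElem _ _ hi] at this

/-- For n ≥ 2 the integer logarithm is at least 1, so 5 (log₂ n + 1) is at most ten times it; this
yields the constant 10 / log 2. -/
theorem isBigO_log : Asymptotics.IsBigO Filter.atTop
    (fun n : ℕ => ((5 * (Nat.log 2 n + 1) : ℕ) : ℝ)) (fun n : ℕ => Real.log (n : ℝ)) := by
  refine Asymptotics.IsBigO.of_bound (10 / Real.log 2) ?_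
  filter_upwards [Filter.eventually_ge_atTop 2] with n hn
  have hlog2 : 0 < Real.log 2 := Real.log_pos (by norm_num)
  have h1 : (1 : ℝ) ≤ Nat.log 2 n := by
    exact_mod_cast Nat.log_pos (by norm_num) hn
  have h2 : (Nat.log 2 n : ℝ) * Real.log 2 ≤ Real.log n := by
    rw [← Real.log_pow]
    refine Real.log_le_log (by positivity) ?_
    exact_mod_cast Nat.pow_log_le_self 2 (by omega)
  have h3 : 0 ≤ Real.log n := Real.log_natCast_nonneg n
  rw [Real.norm_of_nonneg (by positivity), Real.norm_of_nonneg h3, div_mul_eq_mul_div,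
    le_div_iff₀ hlog2]
  push_cast
  nlinarith

end RFTT

theorem mainTheorem3 :
    ∃ ρ : ℕ → ℝ, Asymptotics.IsBigO Filter.atTop ρ (fun n : ℕ => Real.log (n : ℝ)) ∧
      ∃ P : RAM.Cmd, RFTT.IsMinMaxApprox P ρ :=
  ⟨_, RFTT.isBigO_log, RFTT.exists_isMinMaxApprox⟩
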